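/- **Setting.** A *labeled simplex* $\mathscr S$ of dimension $d$ is a combinatorial $d$-simplex with set of facets $S$, $\#S=d+1$, together with a label $\pi/M_{st}$, $M_{st}\in\{2,3,\dots,\infty\}$, on each ridge $s\cap t$. Its Coxeter group is $W=\langle S\mid s^2=1,\ (st)^{M_{st}}=1 \text{ for } M_{st}\neq\infty\rangle$; its Coxeter diagram has node set $S$ and an edge $\overline{st}$ whenever $M_{st}\ge 3$ (including $\infty$). It is *irreducible* if this diagram is connected, and *large* if $W$ has a finite index subgroup with a non-abelian free quotient. A labeled simplex is *perfect* if the Coxeter group of the link of each vertex is spherical (all its components are finite), and *2-perfect* if the link of each vertex is perfect. A *Coxeter polytope* of the projective sphere $\mathbb S(V)$ is a properly convex polytope $P=\{\alpha_s\le 0,\ s\in S\}$ with nonempty interior and exactly $\#S$ facets, together with reflections $\sigma_s=\mathrm{Id}-\alpha_s\otimes b_s$, $\alpha_s(b_s)=2$, such that for $s\ne t$ the numbers $\alpha_s(b_t),\alpha_t(b_s)$ are both zero or both negative, and $\alpha_s(b_t)\alpha_t(b_s)$ is $\geq 4$ or equal to $4\cos^2(\pi/m)$ for some integer $m\ge2$.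 Its Cartan matrix is $A_P=(\alpha_s(b_t))_{s,t}$, and the dihedral angle at the ridge $s\cap t$ is $\pi/m$ if $\alpha_s(b_t)\alpha_t(b_s)=4\cos^2(\pi/m)$ and $0=\pi/\infty$ if this product is $\ge4$. The *deformation space* $\mathcal C(\mathscr S)$ is the space of Coxeter polytopes of $\mathbb S^d=\mathbb S(\mathbb R^{d+1})$ realizing $\mathscr S$ (i.e. equipped with an isomorphism from the face poset of $\mathscr S$ to that of $P$ that turns labels into dihedral angles), up to projective automorphisms of $\mathbb S^d$ preserving the polytopes, the reflections and the markings; it has the quotient of the topology on the families $(\alpha_s,b_s)_{s\in S}$. A Coxeter polytope is *hyperbolic* if the group generated by its reflections is conjugate into $\mathrm O^+_{d,1}(\mathbb R)$. The *Tits simplex* $\Delta_W$ is the Coxeter simplex of $\mathbb S(\mathbb R^S)$ with $\alpha_s=e_s^*$ and $\alpha_s(b_t)=-2\cos(\pi/M_{st})$. A *relevant circuit* $C=(i_1,\dots,i_k)$ is a tuple of distinct nodes running around a cycle of the diagram ($k\ge 3$), or the two ends of an edge of label $\infty$ ($k=2$). Its *normalized cyclic product* is $$R_C(A)=\log\frac{A_{i_1i_2}A_{i_2i_3}\cdots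 A_{i_ki_1}}{A_{i_ki_{k-1}}\cdots A_{i_2i_1}A_{i_1i_k}}.$$ **Theorem.** Let $\mathscr S$ be an irreducible, large, 2-perfect labeled simplex of dimension $d\ge4$ with Coxeter group $W$, and let $e_+$ be the number of edges of its Coxeter diagram. Then: 1. $e_+-d\in\{0,1,2\}$, and $\mathcal C(\mathscr S)$ is an open cell of dimension $e_+-d$, i.e. it is homeomorphic to $\mathbb R^{e_+-d}$. 2. $\mathcal C(\mathscr S)$ is parametrized by normalized cyclic products: the map $[P]\mapsto (R_C(A_P))_C$, where $C$ runs over all relevant circuits, is well defined, and it is a homeomorphism from $\mathcal C(\mathscr S)$ onto a linear subspace, of dimension $e_+-d$, of the space of all real families indexed by the relevant circuits. 3. The Tits simplex $\Delta_W$ realizes $\mathscr S$, and a Coxeter simplex $P$ realizing $\mathscr S$ is hyperbolic if and only if $[P]=[\Delta_W]$; so $\mathcal C(\mathscr S)$ contains exactly one class of hyperbolic simplices, that of $\Delta_W$. -/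

import Mathlib

open Topology

namespace ProjCoxeter

/-! ### Coxeter matrices and Coxeter groups

In `CoxeterMatrix` the entry `0` stands for the label `∞`. -/

section CoxeterGroups

variable {S : Type*}

/-- The underlying graph of the Coxeter diagram: `s` and `t` are joined by an edge
iff `M s t ∈ {3, 4, …, ∞}`. -/
def diagram (M : CoxeterMatrix S) : SimpleGraph S where
  Adj s t := s ≠ t ∧ M s t ≠ 2
  symm := ⟨fun s t h => ⟨h.1.symm, by rw [M.symmetric t s]; exact h.2⟩⟩
  loopless := ⟨fun _ h => h.1 rfl⟩

/-- The restriction of a Coxeter matrix to the subset of the indices with property `p`; its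
Coxeter group is the corresponding standard subgroup. -/
def restrict (M : CoxeterMatrix S) (p : S → Prop) : CoxeterMatrix {s // p s} where
  M := M.M.submatrix Subtype.val Subtype.val
  isSymm := M.isSymm.submatrix _
  diagonal s := M.diagonal s.1
  off_diagonal s t h := M.off_diagonal s.1 t.1 fun e => h (Subtype.ext e)

/-- A Coxeter group is irreducible if its diagram is connected. -/
def IsIrreducible (M : CoxeterMatrix S) : Prop := (diagram M).Connected

/-- A Coxeter group is spherical if each of its components is finite. -/
def IsSpherical (M : CoxeterMatrix S) : Prop :=
  ∀ c : (diagram M).ConnectedComponent, Finite (restrict M (· ∈ c.supp)).Group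

/-- A group is large if it has a finite index subgroup with a non-abelian free quotient. -/
def IsLargeGroup (G : Type*) [Group G] : Prop :=
  ∃ H : Subgroup G, H.FiniteIndex ∧
    ∃ (X : Type) (_ : Nontrivial X) (f : H →* FreeGroup X), Function.Surjective f

/-- The number `e₊` of edges of the Coxeter diagram. -/
noncomputable def edgeCount (M : CoxeterMatrix S) : ℕ := (diagram M).edgeSet.ncard

end CoxeterGroups

/-! ### Labeled simplices

A labeled simplex with set of facets `S` is a Coxeter matrix `M` on `S`: the ridge `s ∩ t` carries
the label `π / M s t`. Its dimension is `#S - 1`. Its vertices are in bijection with `S`, through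
the facet opposite to the vertex. -/

section LabeledSimplices

variable {S : Type*}

/-- The link of a labeled simplex at the vertex opposite to the facet `s`: the facets of the link
are the facets containing this vertex, i.e. all facets except `s`. -/
def link (M : CoxeterMatrix S) (s : S) : CoxeterMatrix {t // t ≠ s} := restrict M (· ≠ s)

/-- A labeled simplex is perfect if all its vertex links are spherical. -/
def IsPerfect (M : CoxeterMatrix S) : Prop := ∀ s, IsSpherical (link M s)

/-- A labeled simplex is 2-perfect if all its vertex links are perfect. -/
def IsTwoPerfect (M : CoxeterMatrix S) : Prop := ∀ s, IsPerfect (link M s)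

end LabeledSimplices

/-! ### Cartan matrices, in the sense of Vinberg -/

structure IsCartanMatrix {S : Type*} (A : S → S → ℝ) : Prop where
  diag : ∀ s, A s s = 2
  sign : ∀ s t, s ≠ t → (A s t = 0 ∧ A t s = 0) ∨ (A s t < 0 ∧ A t s < 0)
  prod : ∀ s t, s ≠ t → 4 ≤ A s t * A t s ∨
    ∃ m : ℕ, 2 ≤ m ∧ A s t * A t s = 4 * Real.cos (Real.pi / m) ^ 2

/-! ### Coxeter polytopes

A subset of the projective sphere `𝕊(V)` (the space of half-lines of `V`) is represented by the cone
over it in `V`, with `0` added. -/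

/-- A Coxeter polytope of `𝕊(V)` with facets indexed by `S`, presented by linear forms `α s` and
vectors `b s`: the polytope is `{α s ≤ 0 for all s}` and the reflections are
`σ s = Id - α s ⊗ b s`. The polytope and the reflections determine `(α s, b s)` up to
`(α s, b s) ↦ (λ s • α s, (λ s)⁻¹ • b s)` with `λ s > 0`; isomorphism, defined below, only sees the
polytope and the reflections. -/
structure CoxeterPolytope (S V : Type*) [AddCommGroup V] [Module ℝ V] [TopologicalSpace V] where
  α : S → Module.Dual ℝ V
  b : S → V
  /-- The Cartan matrix `(α s (b t))` of the polytope satisfies Vinberg's conditions;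
  in particular `α s (b s) = 2`. -/
  isCartan : IsCartanMatrix fun s t => α s (b t)
  /-- The polytope has nonempty interior. -/
  interior_nonempty : (interior {x : V | ∀ s, α s x ≤ 0}).Nonempty
  /-- The polytope is properly convex: it lies in an affine chart `{f > 0}` of `𝕊(V)`. -/
  properly_convex : ∃ f : Module.Dual ℝ V, ∀ x : V, (∀ s, α s x ≤ 0) → x ≠ 0 → 0 < f x
  /-- None of the inequalities `α s ≤ 0` is superfluous, i.e. the polytope has exactly the
  facets `P ∩ {α s = 0}`, one for each `s`. -/
  irredundant : ∀ s, ∃ x : V, 0 < α s x ∧ ∀ t, t ≠ s → α t x ≤ 0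

/-- Faces of (the cone over) a projective polytope: intersections with supporting hyperplanes, and
the polytope itself. The cone `{0}` represents the empty face. -/
def IsFace {V : Type*} [AddCommGroup V] [Module ℝ V] (K F : Set V) : Prop :=
  ∃ l : Module.Dual ℝ V, (∀ x ∈ K, l x ≤ 0) ∧ F = {x ∈ K | l x = 0}

namespace CoxeterPolytope

variable {S V : Type*} [AddCommGroup V] [Module ℝ V] [TopologicalSpace V]

/-- The underlying projective polytope (as a cone). -/
def carrier (P : CoxeterPolytope S V) : Set V := {x | ∀ s, P.α s x ≤ 0}

/-- The facet `s`. -/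
def facet (P : CoxeterPolytope S V) (s : S) : Set V := {x ∈ P.carrier | P.α s x = 0}

/-- The reflection `σ s : x ↦ x - α s x • b s`. -/
noncomputable def refl (P : CoxeterPolytope S V) (s : S) : V ≃ₗ[ℝ] V :=
  Module.reflection (P.isCartan.diag s)

/-- The group generated by the reflections. -/
def reflectionGroup (P : CoxeterPolytope S V) : Subgroup (V ≃ₗ[ℝ] V) :=
  Subgroup.closure (Set.range P.refl)

/-- The Cartan matrix. -/
def cartanMatrix (P : CoxeterPolytope S V) : S → S → ℝ := fun s t => P.α s (P.b t)

/-- The dihedral angle at the ridge `s ∩ t` is `π / m`, where `m = 0` stands for `m = ∞`. -/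
def HasDihedralAngle (P : CoxeterPolytope S V) (s t : S) (m : ℕ) : Prop :=
  if m = 0 then 4 ≤ P.cartanMatrix s t * P.cartanMatrix t s
  else P.cartanMatrix s t * P.cartanMatrix t s = 4 * Real.cos (Real.pi / m) ^ 2

/-- `P` realizes the labeled simplex `M`. The face poset of the simplex with set of facets `S` is
the poset of all subsets of `S` ordered by reverse inclusion (a face corresponds to the set of
facets containing it). It is required to be isomorphic to the face poset of `P`, such that
the facet `s` of the simplex goes to the facet `s` of `P`; such a poset isomorphism is unique, so
the marking is recorded by the indexing of the facets of `P` by `S`. -/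
def Realizes (P : CoxeterPolytope S V) (M : CoxeterMatrix S) : Prop :=
  (∃ φ : (Set S)ᵒᵈ ≃o {F : Set V // IsFace P.carrier F},
    ∀ s, (φ (OrderDual.toDual {s}) : Set V) = P.facet s) ∧
  ∀ s t, s ≠ t → P.HasDihedralAngle s t (M s t)

/-- Isomorphism of marked Coxeter polytopes: a projective automorphism carrying polytope to
polytope, each facet to the facet with the same mark, and reflections to reflections. (Every linear
automorphism of `V` induces an automorphism of `𝕊(V)`, and is a positive multiple of one with
determinant `±1`.) -/
def Isomorphic (P P' : CoxeterPolytope S V) : Prop :=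
  ∃ ψ : V ≃ₗ[ℝ] V, ψ '' P.carrier = P'.carrier ∧ (∀ s, ψ '' P.facet s = P'.facet s) ∧
    ∀ s x, ψ (P.refl s x) = P'.refl s (ψ x)

theorem Isomorphic.equivalence : Equivalence (Isomorphic (S := S) (V := V)) where
  refl P := ⟨LinearEquiv.refl ℝ V, Set.image_id _, fun _ => Set.image_id _, fun _ _ => rfl⟩
  symm := by
    rintro P P' ⟨ψ, h1, h2, h3⟩
    refine ⟨ψ.symm, ?_, fun s => ?_, fun s x => ?_⟩
    · rw [← h1, ← Set.image_comp]; simp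
    · rw [← h2, ← Set.image_comp]; simp
    · apply ψ.injective; simp [h3]
  trans := by
    rintro P P' P'' ⟨ψ, h1, h2, h3⟩ ⟨ψ', h1', h2', h3'⟩
    refine ⟨ψ.trans ψ', ?_, fun s => ?_, fun s x => ?_⟩
    · rw [← h1', ← h1, ← Set.image_comp]; rfl
    · rw [← h2', ← h2, ← Set.image_comp]; rfl
    · simp [h3, h3']

/-- The space of Coxeter polytopes, as a subspace of the space of all families
`(α s, b s)` in `(V* × V)^S`; `V*` carries the topology of pointwise convergence (its usual topology
when `V` has finite dimension). -/
instance : TopologicalSpace (CoxeterPolytope S V) :=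
  TopologicalSpace.induced
    (fun P => ((fun s x => P.α s x, P.b) : (S → V → ℝ) × (S → V))) inferInstance

end CoxeterPolytope

/-- The Lorentzian form of signature `(d, 1)` on `ℝ^(d+1)`. -/
def lorentzForm (d : ℕ) (x y : Fin (d + 1) → ℝ) : ℝ :=
  ∑ i : Fin d, x i.castSucc * y i.castSucc - x (Fin.last d) * y (Fin.last d)

/-- The elements of `O⁺(d,1)`: the linear automorphisms preserving the Lorentzian form and
the upper half of the time cone. -/
def IsOPlus (d : ℕ) (g : (Fin (d + 1) → ℝ) ≃ₗ[ℝ] (Fin (d + 1) → ℝ)) : Prop :=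
  (∀ x y, lorentzForm d (g x) (g y) = lorentzForm d x y) ∧
  ∀ x, lorentzForm d x x < 0 → 0 < x (Fin.last d) → 0 < g x (Fin.last d)

/-- A Coxeter polytope is hyperbolic if its reflection group is conjugate into `O⁺(d,1)`. -/
def CoxeterPolytope.IsHyperbolic {S V : Type*} [AddCommGroup V] [Module ℝ V] [TopologicalSpace V]
    (d : ℕ) (P : CoxeterPolytope S V) : Prop :=
  ∃ g : V ≃ₗ[ℝ] (Fin (d + 1) → ℝ), ∀ γ ∈ P.reflectionGroup,
    IsOPlus d ((g.symm.trans γ).trans g)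

/-! ### The deformation space of a labeled simplex

For a simplex with `#S = d + 1` facets, the projective sphere of dimension `d` is `𝕊(ℝ^S)`. -/

/-- The Coxeter polytopes realizing the labeled simplex `M`, with the subspace topology. -/
abbrev Realization {S : Type*} (M : CoxeterMatrix S) : Type _ :=
  {P : CoxeterPolytope S (S → ℝ) // P.Realizes M}

/-- Isomorphism of realizations. -/
instance realizationSetoid {S : Type*} (M : CoxeterMatrix S) : Setoid (Realization M) :=
  Setoid.comap Subtype.val ⟨_, CoxeterPolytope.Isomorphic.equivalence⟩

/-- The deformation space: isomorphism classes of Coxeter polytopes realizing `M`, with the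
quotient topology. -/
def DeformationSpace {S : Type*} (M : CoxeterMatrix S) : Type _ :=
  Quotient (realizationSetoid M)

instance {S : Type*} (M : CoxeterMatrix S) : TopologicalSpace (DeformationSpace M) :=
  inferInstanceAs (TopologicalSpace (Quotient (realizationSetoid M)))

/-- The isomorphism class of a Coxeter polytope realizing `M`. -/
def DeformationSpace.mk {S : Type*} {M : CoxeterMatrix S} (P : CoxeterPolytope S (S → ℝ))
    (h : P.Realizes M) : DeformationSpace M :=
  Quotient.mk (realizationSetoid M) ⟨P, h⟩

/-! ### Cyclic products -/

/-- A relevant circuit `(c 0, …, c (k-1))`: a tuple of distinct nodes running around a cycle of the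
diagram, or the two ends of an edge of label `∞`. -/
structure RelevantCircuit {S : Type*} (M : CoxeterMatrix S) where
  k : ℕ
  c : Fin k → S
  injective : Function.Injective c
  relevant : (3 ≤ k ∧ ∀ i, (diagram M).Adj (c i) (c (finRotate k i))) ∨
    (k = 2 ∧ ∀ i, M (c i) (c (finRotate k i)) = 0)

/-- The cyclic product `A (c 0) (c 1) * A (c 1) (c 2) * ⋯ * A (c (k-1)) (c 0)`. -/
def cyclicProduct {S : Type*} (A : S → S → ℝ) {k : ℕ} (c : Fin k → S) : ℝ :=
  ∏ i, A (c i) (c (finRotate k i))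

/-- The normalized cyclic product `log (C(A) / C̄(A))`, where `C̄` is the opposite circuit. -/
noncomputable def normalizedCyclicProduct {S : Type*} {M : CoxeterMatrix S} (A : S → S → ℝ)
    (C : RelevantCircuit M) : ℝ :=
  Real.log (cyclicProduct A C.c / cyclicProduct A (C.c ∘ Fin.rev))

/-! ### The Tits simplex -/

/-- The Coxeter simplex `{x s ≤ 0 for all s}` in `𝕊(ℝ^S)` of a Cartan matrix `A`: here `α s` is the
`s`-th coordinate and `b t` is the `t`-th column of `A`. -/
def coxeterSimplex {S : Type*} [Finite S] (A : S → S → ℝ) (hA : IsCartanMatrix A) :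
    CoxeterPolytope S (S → ℝ) where
  α s := LinearMap.proj s
  b t := fun s => A s t
  isCartan := hA
  interior_nonempty := by
    refine ⟨fun _ => -1, mem_interior.2 ⟨Set.univ.pi fun _ => Set.Iio 0, ?_, ?_, ?_⟩⟩
    · intro x hx s
      exact le_of_lt (hx s (Set.mem_univ s))
    · exact isOpen_set_pi Set.finite_univ fun _ _ => isOpen_Iio
    · intro s _
      simp
  properly_convex := by
    have := Fintype.ofFinite S
    refine ⟨-∑ s, LinearMap.proj s, fun x hx h0 => ?_⟩
    obtain ⟨s, hs⟩ := Function.ne_iff.1 h0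
    have h : ∑ t, x t < 0 :=
      Finset.sum_neg' (fun t _ => hx t) ⟨s, Finset.mem_univ s, lt_of_le_of_ne (hx s) hs⟩
    simpa using h
  irredundant := by
    classical
    intro s
    refine ⟨Pi.single s 1, by simp, fun t ht => ?_⟩
    simp [ht]

/-- The cosine matrix `-2 cos (π / M s t)`. For `M s t = ∞`, written `0`, the quotient `π / 0`
is `0` in Lean and the entry is `-2`, as it should be. -/
noncomputable def cosineMatrix {S : Type*} (M : CoxeterMatrix S) : S → S → ℝ :=
  fun s t => -2 * Real.cos (Real.pi / M s t)

theorem isCartanMatrix_cosineMatrix {S : Type*} (M : CoxeterMatrix S) :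
    IsCartanMatrix (cosineMatrix M) where
  diag s := by simp [cosineMatrix]
  sign s t h := by
    have h1 := M.off_diagonal s t h
    simp only [cosineMatrix, M.symmetric t s]
    rcases eq_or_ne (M s t) 2 with h2 | h2
    · left; simp [h2]
    · right
      have hc : 0 < Real.cos (Real.pi / M s t) := by
        rcases eq_or_ne (M s t) 0 with h0 | h0
        · simp [h0]
        · have h3 : 3 ≤ M s t := by
            have : M.M s t = M s t := rfl
            omega
          have h3' : (3 : ℝ) ≤ M s t := by exact_mod_cast h3
          apply Real.cos_pos_of_mem_Ioo
          constructor
          · have : 0 < Real.pi / M s t := by have := Real.pi_pos; positivity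
            linarith [Real.pi_pos]
          · exact div_lt_div_of_pos_left Real.pi_pos (by norm_num) (by linarith)
      constructor <;> linarith
  prod s t h := by
    have h1 := M.off_diagonal s t h
    simp only [cosineMatrix, M.symmetric t s]
    rcases eq_or_ne (M s t) 0 with h0 | h0
    · left; norm_num [h0]
    · right
      exact ⟨M s t, by have : M.M s t = M s t := rfl
                       omega, by ring⟩

/-- The Tits simplex of a Coxeter group. -/
noncomputable def titsSimplex {S : Type*} [Finite S] (M : CoxeterMatrix S) :
    CoxeterPolytope S (S → ℝ) :=
  coxeterSimplex (cosineMatrix M) (isCartanMatrix_cosineMatrix M)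

end ProjCoxeter

open ProjCoxeter

/-!
Let `B` be the form with matrix `cosineMatrix M`, and `n = d + 1` the number of nodes.

**Signature.** A finite Coxeter group has positive definite form: an inner product invariant under
the geometric representation has to agree with `B` up to rescaling the basis vectors
(`cosForm_pos_of_finite`). Hence, for a 2-perfect simplex, `B` is positive on all nonzero vectors
with two zero coordinates (`IsTwoPerfect.isTwoPositive`). Comparing a vector with its positive and
negative parts, one sees that then `B` is not nonpositive on any plane
(`not_cosForm_nonpos_of_independent`), so `B` has at most one eigenvalue `≤ 0`. If `B` were positive
semidefinite, then by Tits's theorem on the signs of roots (`geomRep_single_nonneg`) the group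
would act on a Euclidean space with a uniformly discrete orbit growing linearly with the word
length. It would have polynomial growth, which excludes the free semigroup of rank two contained in
a large group (`not_isLargeGroup_of_posSemidef`). So `B` has signature `(d, 1)`
(`exists_lorentz_gram`).

**Number of edges.** There are no labels `∞` because `n ≥ 5`. Evaluating `B` at the vector with
coordinates `0` at two nodes and `1` elsewhere shows that the diagram without these two nodes has
fewer than `n - 2` edges; summing over all pairs of nodes gives `e₊ ≤ d + 2` (`edgeCount_le`).

**Deformations.** Since a realization is properly convex, its forms `α s` are coordinates, and
isomorphism of realizations is conjugation of Cartan matrices by positive diagonal matrices. The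
products `A s t * A t s` being prescribed, a Cartan matrix amounts to the antisymmetric function
`log (A s t / A t s)` on the oriented edges, and conjugation adds a coboundary. The normalized
cyclic products are the integrals of this cochain over the cycles of the diagram. They vanish only
on coboundaries (`exists_potential`, via a spanning tree), so they identify the deformation space
with the first cohomology of the diagram, a vector space of dimension `e₊ - d`
(`exists_homeomorph`, `finrank_range_circuitIntegral`).

**Hyperbolic simplices.** If the reflections preserve a Lorentzian form `Q`, then `2 Q(b s, ·)` is
`Q(b s, b s) α s`; so the Cartan matrix is symmetrizable, and its normalized cyclic products vanish,
as they do for the Tits simplex. Conversely, as `B` has signature `(d, 1)`, it is the Gram matrix of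
a basis of `ℝ^(d,1)`, in which the Tits simplex becomes hyperbolic.
-/

namespace ProjCoxeter

/-! ### The geometric representation of a Coxeter group -/

theorem cosineMatrix_self {S : Type*} (M : CoxeterMatrix S) (s : S) : cosineMatrix M s s = 2 :=
  (isCartanMatrix_cosineMatrix M).diag s

theorem cosineMatrix_symm {S : Type*} (M : CoxeterMatrix S) (s t : S) :
    cosineMatrix M s t = cosineMatrix M t s := by
  simp only [cosineMatrix, M.symmetric s t]

open Polynomial.Chebyshev in
/-- For `θ = 2π/m`, the coefficients of `Module.reflection_mul_reflection_pow_apply` vanish. -/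
theorem chebyshev_coeff_eq_zero {m : ℕ} (hm : 3 ≤ m) {t : ℝ}
    (ht : t = 2 * Real.cos (2 * Real.pi / m)) :
    ((S ℝ (((m : ℤ) - 2) / 2)).eval t *
      ((S ℝ (((m : ℤ) - 1) / 2)).eval t + (S ℝ (((m : ℤ) - 3) / 2)).eval t)) = 0 ∧
    ((S ℝ (((m : ℤ) - 1) / 2)).eval t *
      ((S ℝ ((m : ℤ) / 2)).eval t + (S ℝ (((m : ℤ) - 2) / 2)).eval t)) = 0 := by
  have hm' : (3 : ℝ) ≤ m := by exact_mod_cast hm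
  have hpi := Real.pi_pos
  set θ := 2 * Real.pi / m with hθ
  have hθm : θ * m = 2 * Real.pi := by rw [hθ]; field_simp
  have hs : Real.sin θ ≠ 0 := by
    apply ne_of_gt
    apply Real.sin_pos_of_pos_of_lt_pi
    · positivity
    · rw [hθ, div_lt_iff₀ (by linarith)]; nlinarith
  have hS (n : ℤ) : (S ℝ n).eval t * Real.sin θ = Real.sin ((n + 1) * θ) := by
    rw [ht]; exact S_two_mul_real_cos θ n
  obtain ⟨k, hk⟩ := Nat.even_or_odd' m
  rcases hk with hk | hk
  · have e1 : ((m : ℤ) - 2) / 2 = k - 1 := by omega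
    have e2 : ((m : ℤ) - 1) / 2 = k - 1 := by omega
    have h0 : (S ℝ ((k : ℤ) - 1)).eval t = 0 := by
      have := hS (k - 1)
      have e : (((k : ℤ) - 1 : ℤ) + 1 : ℝ) * θ = Real.pi := by
        have : (m : ℝ) = 2 * k := by exact_mod_cast hk
        push_cast; rw [this] at hθm; linarith
      rw [e, Real.sin_pi] at this
      exact (mul_eq_zero.1 this).resolve_right hs
    rw [e1, e2, h0]; simp
  · have e1 : ((m : ℤ) - 2) / 2 = k - 1 := by omega
    have e2 : ((m : ℤ) - 1) / 2 = k := by omega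
    have e3 : ((m : ℤ) - 3) / 2 = k - 1 := by omega
    have e4 : (m : ℤ) / 2 = k := by omega
    have h0 : (S ℝ (k : ℤ)).eval t + (S ℝ ((k : ℤ) - 1)).eval t = 0 := by
      have h1 := hS k
      have h2 := hS (k - 1)
      have e : ((k : ℤ) + 1 : ℝ) * θ = 2 * Real.pi - (((k : ℤ) - 1 : ℤ) + 1 : ℝ) * θ := by
        have : (m : ℝ) = 2 * k + 1 := by exact_mod_cast hk
        push_cast; rw [this] at hθm; linarith
      rw [e, Real.sin_two_pi_sub] at h1
      have : ((S ℝ (k : ℤ)).eval t + (S ℝ ((k : ℤ) - 1)).eval t) * Real.sin θ = 0 := by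
        rw [add_mul, h1, h2]; ring
      exact (mul_eq_zero.1 this).resolve_right hs
    rw [e1, e2, e3, e4, h0]; simp

section GeometricRepresentation

variable {S : Type*} [Fintype S] [DecidableEq S] (M : CoxeterMatrix S)

/-- The symmetric bilinear form on `ℝ^S` with matrix `cosineMatrix M`. It is twice Tits's canonical
form: the basis vectors have square length `2`. -/
noncomputable def cosForm : LinearMap.BilinForm ℝ (S → ℝ) :=
  Matrix.toBilin' (Matrix.of (cosineMatrix M))

theorem cosForm_apply (v w : S → ℝ) :
    cosForm M v w = ∑ s, ∑ t, v s * cosineMatrix M s t * w t := by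
  simp [cosForm, Matrix.toBilin'_apply]

theorem cosForm_single (s t : S) :
    cosForm M (Pi.single s 1) (Pi.single t 1) = cosineMatrix M s t := by
  simp [cosForm, Matrix.toBilin'_single]

theorem cosForm_single_self (s : S) : cosForm M (Pi.single s 1) (Pi.single s 1) = 2 := by
  rw [cosForm_single, cosineMatrix_self]

theorem cosForm_comm (v w : S → ℝ) : cosForm M v w = cosForm M w v := by
  rw [cosForm_apply, cosForm_apply, Finset.sum_comm]
  refine Finset.sum_congr rfl fun s _ => Finset.sum_congr rfl fun t _ => ?_
  rw [cosineMatrix_symm M t s]; ring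

/-- The reflection `v ↦ v - B(e_s, v) e_s` of `ℝ^S`, where `B` is `cosForm M`. -/
noncomputable def simpleReflection (s : S) : (S → ℝ) ≃ₗ[ℝ] (S → ℝ) :=
  Module.reflection (f := cosForm M (Pi.single s 1)) (cosForm_single_self M s)

theorem simpleReflection_apply (s : S) (v : S → ℝ) :
    simpleReflection M s v = v - cosForm M (Pi.single s 1) v • Pi.single s 1 := by
  simp [simpleReflection, Module.reflection_apply]

theorem simpleReflection_mul_self (s : S) : simpleReflection M s * simpleReflection M s = 1 := by
  ext1 v
  exact Module.involutive_reflection _ v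

theorem cosForm_simpleReflection (s : S) (v w : S → ℝ) :
    cosForm M (simpleReflection M s v) (simpleReflection M s w) = cosForm M v w := by
  simp only [simpleReflection_apply, map_sub, map_smul, LinearMap.sub_apply, LinearMap.smul_apply,
    cosForm_single_self, smul_eq_mul, cosForm_comm M v (Pi.single s 1)]
  ring

/-- The simple reflections satisfy the Coxeter relations. -/
theorem isLiftable_simpleReflection : M.IsLiftable (simpleReflection M) := by
  intro s t
  rcases eq_or_ne s t with rfl | hst
  · rw [simpleReflection_mul_self, one_pow]
  have h1 : M s t ≠ 1 := M.off_diagonal s t hst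
  have hc : cosForm M (Pi.single t 1) (Pi.single s 1) = cosForm M (Pi.single s 1) (Pi.single t 1) :=
    cosForm_comm M _ _
  have hv : cosForm M (Pi.single s 1) (Pi.single t 1) = -2 * Real.cos (Real.pi / M s t) := by
    rw [cosForm_single]; rfl
  obtain h0 | h2 | h3 : M s t = 0 ∨ M s t = 2 ∨ 3 ≤ M s t := by omega
  · rw [h0, pow_zero]
  · have hv0 : cosForm M (Pi.single s 1) (Pi.single t 1) = 0 := by rw [hv, h2]; simp
    rw [h2]
    ext1 v
    simp only [pow_two, LinearEquiv.mul_apply, simpleReflection_apply, map_sub, map_smul, hc, hv0,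
      cosForm_single_self]
    simp only [LinearEquiv.coe_one, id]
    module
  · ext1 v
    obtain ⟨c1, c2⟩ := chebyshev_coeff_eq_zero h3
      (t := cosForm M (Pi.single s 1) (Pi.single t 1) *
        cosForm M (Pi.single t 1) (Pi.single s 1) - 2)
      (by rw [hc, hv, mul_div_assoc, Real.cos_two_mul]; ring)
    have := Module.reflection_mul_reflection_pow_apply
      (f := cosForm M (Pi.single s 1)) (g := cosForm M (Pi.single t 1))
      (cosForm_single_self M s) (cosForm_single_self M t) (M s t) v
    rw [simpleReflection, simpleReflection, this, c1, c2]
    simp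

/-- The geometric representation of a Coxeter group on `ℝ^S`. -/
noncomputable def geomRep : M.Group →* ((S → ℝ) ≃ₗ[ℝ] (S → ℝ)) :=
  M.toCoxeterSystem.lift ⟨simpleReflection M, isLiftable_simpleReflection M⟩

theorem geomRep_simple (s : S) : geomRep M (M.toCoxeterSystem.simple s) = simpleReflection M s :=
  M.toCoxeterSystem.lift_apply_simple _ s

theorem cosForm_geomRep (w : M.Group) (x y : S → ℝ) :
    cosForm M (geomRep M w x) (geomRep M w y) = cosForm M x y := by
  induction w using M.toCoxeterSystem.simple_induction_left generalizing x y with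
  | one => simp
  | mul_simple_left w s ih =>
    simp only [map_mul, geomRep_simple, LinearEquiv.mul_apply, cosForm_simpleReflection, ih]

theorem cosForm_geomRep_inv (w : M.Group) (x y : S → ℝ) :
    cosForm M (geomRep M w⁻¹ x) y = cosForm M x (geomRep M w y) := by
  rw [← cosForm_geomRep M w, ← LinearEquiv.mul_apply, ← map_mul]
  simp

end GeometricRepresentation

/-! ### Tits's theorem on the signs of roots -/

section Tits

variable {S : Type*} [Fintype S] [DecidableEq S] (M : CoxeterMatrix S)

/-- The sequence `sin (j π / m) / sin (π / m)`, continued by `j` if `m = 0` stands for `∞`. It gives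
the coordinates of the roots of a dihedral group. -/
noncomputable def dihedralCoeff (m j : ℕ) : ℝ :=
  if m = 0 then j else Real.sin (j * (Real.pi / m)) / Real.sin (Real.pi / m)

theorem sin_pi_div_pos {m : ℕ} (hm : 2 ≤ m) : 0 < Real.sin (Real.pi / m) := by
  have hm' : (2 : ℝ) ≤ m := by exact_mod_cast hm
  have hpi := Real.pi_pos
  apply Real.sin_pos_of_pos_of_lt_pi (by positivity)
  rw [div_lt_iff₀ (by linarith)]; nlinarith

theorem dihedralCoeff_zero (m : ℕ) : dihedralCoeff m 0 = 0 := by simp [dihedralCoeff]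

theorem dihedralCoeff_one {m : ℕ} (hm : m ≠ 1) : dihedralCoeff m 1 = 1 := by
  unfold dihedralCoeff
  split_ifs with h
  · simp
  · rw [Nat.cast_one, one_mul, div_self (sin_pi_div_pos (by omega)).ne']

theorem dihedralCoeff_add_two (m j : ℕ) :
    dihedralCoeff m (j + 2) =
      2 * Real.cos (Real.pi / m) * dihedralCoeff m (j + 1) - dihedralCoeff m j := by
  unfold dihedralCoeff
  split_ifs with h
  · simp [h]; ring
  · have : Real.sin ((j + 2 : ℕ) * (Real.pi / m)) =
        2 * Real.cos (Real.pi / m) * Real.sin ((j + 1 : ℕ) * (Real.pi / m)) -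
          Real.sin (j * (Real.pi / m)) := by
      have e1 : ((j + 2 : ℕ) : ℝ) * (Real.pi / m) = (j + 1 : ℕ) * (Real.pi / m) + Real.pi / m := by
        push_cast; ring
      have e2 : (j : ℝ) * (Real.pi / m) = (j + 1 : ℕ) * (Real.pi / m) - Real.pi / m := by
        push_cast; ring
      rw [e1, e2, Real.sin_add, Real.sin_sub]; ring
    rw [this]; ring

theorem dihedralCoeff_nonneg {m j : ℕ} (h : m = 0 ∨ j ≤ m) : 0 ≤ dihedralCoeff m j := by
  unfold dihedralCoeff
  split_ifs with h0
  · positivity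
  · have hj : j ≤ m := h.resolve_left h0
    have hm : (0 : ℝ) < m := by positivity
    have key (i : ℕ) (hi : i ≤ m) : 0 ≤ Real.sin (i * (Real.pi / m)) := by
      apply Real.sin_nonneg_of_nonneg_of_le_pi (by positivity)
      have : (i : ℝ) ≤ m := by exact_mod_cast hi
      calc (i : ℝ) * (Real.pi / m) ≤ m * (Real.pi / m) := by gcongr
        _ = Real.pi := by field_simp
    refine div_nonneg (key j hj) ?_
    simpa using key 1 (by omega)

open CoxeterSystem in
/-- The action of the element `⋯ t s t` (with `j` letters) of a dihedral group on `e_s`. -/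
theorem geomRep_alternatingWord_single {s t : S} (hst : s ≠ t) (j : ℕ) :
    geomRep M (M.toCoxeterSystem.wordProd (alternatingWord s t j)) (Pi.single s 1) =
      dihedralCoeff (M s t) (j + 1) • Pi.single (if Even j then s else t) 1 +
        dihedralCoeff (M s t) j • Pi.single (if Even j then t else s) 1 := by
  have h1 : M s t ≠ 1 := M.off_diagonal s t hst
  have hc : cosineMatrix M s t = -2 * Real.cos (Real.pi / M s t) := rfl
  have hc' := cosineMatrix_symm M t s
  induction j with
  | zero => simp [alternatingWord, dihedralCoeff_zero, dihedralCoeff_one h1]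
  | succ j ih =>
    rw [alternatingWord_succ', CoxeterSystem.wordProd_cons, map_mul, LinearEquiv.mul_apply, ih,
      geomRep_simple, dihedralCoeff_add_two]
    by_cases hj : Even j
    · have hj' : ¬ Even (j + 1) := by simp [hj, parity_simps]
      simp only [hj, hj', if_true, if_false, simpleReflection_apply, map_add, map_smul,
        cosForm_single, hc', hc, cosineMatrix_self]
      module
    · have hj' : Even (j + 1) := by simp [hj, parity_simps]
      simp only [hj, hj', if_true, if_false, simpleReflection_apply, map_add, map_smul,
        cosForm_single, hc, cosineMatrix_self]
      module

open CoxeterSystem in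
/-- **Tits**: if `ℓ (w s) > ℓ w`, then the root `w e_s` is positive. A suffix of `w` of maximal
length in the dihedral group of `s` and a right descent `t` of `w` is split off; it sends `e_s` to a
positive combination of `e_s` and `e_t`, and induction applies to the remaining prefix. -/
theorem geomRep_single_nonneg (w : M.Group) (s : S)
    (hs : ¬ M.toCoxeterSystem.IsRightDescent w s) (r : S) :
    0 ≤ geomRep M w (Pi.single s 1) r := by
  set cs := M.toCoxeterSystem
  induction hn : cs.length w using Nat.strong_induction_on generalizing w s with
  | _ n ih =>
  rcases eq_or_ne w 1 with rfl | hw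
  · by_cases h : r = s <;> simp [h]
  obtain ⟨t, ht⟩ := cs.exists_rightDescent_of_ne_one hw
  have hst : s ≠ t := by rintro rfl; exact hs ht
  let p : ℕ → Prop := fun j =>
    ∃ v, w = v * cs.wordProd (alternatingWord s t j) ∧ cs.length w = cs.length v + j
  have hp1 : p 1 := by
    refine ⟨w * cs.simple t, by simp [alternatingWord], ?_⟩
    exact (cs.isRightDescent_iff.1 ht).symm
  classical
  have hle : 1 ≤ cs.length w := by
    obtain ⟨v, -, h⟩ := hp1; omega
  obtain ⟨j, hj⟩ : ∃ j, Nat.findGreatest p (cs.length w) = j := ⟨_, rfl⟩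
  have hj1 : 1 ≤ j := hj ▸ Nat.le_findGreatest hle hp1
  obtain ⟨v, hv, hlen⟩ : p j := hj ▸ Nat.findGreatest_spec hle hp1
  have hmax : ¬ p (j + 1) := fun h => by
    have h' := h
    obtain ⟨v', -, h2⟩ := h'
    have := Nat.le_findGreatest (P := p) (n := cs.length w) (m := j + 1) (by omega) h
    omega
  have hbig : ¬ cs.IsRightDescent v (if Even j then t else s) := by
    intro h
    refine hmax ⟨v * cs.simple (if Even j then t else s), ?_, ?_⟩
    · rw [alternatingWord_succ', wordProd_cons, mul_assoc, simple_mul_simple_cancel_left]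
      exact hv
    · have := cs.isRightDescent_iff.1 h
      omega
  have hsmall : ¬ cs.IsRightDescent v (if Even j then s else t) := by
    intro h
    obtain ⟨i, rfl⟩ : ∃ i, j = i + 1 := ⟨j - 1, by omega⟩
    have hpar : (if Even (i + 1) then s else t) = if Even i then t else s := by
      by_cases hi : Even i <;> simp [hi, parity_simps]
    rw [hpar] at h
    have h1 := cs.isRightDescent_iff.1 h
    have h2 : cs.length w ≤ cs.length (v * cs.simple (if Even i then t else s)) + i := by
      conv_lhs => rw [hv, alternatingWord_succ', wordProd_cons, ← mul_assoc]
      refine (cs.length_mul_le _ _).trans ?_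
      gcongr
      exact (cs.length_wordProd_le _).trans (by simp)
    omega
  have hpos : ∀ a, (a = s ∨ a = t) → 0 ≤ geomRep M v (Pi.single a 1) r := by
    intro a ha
    refine ih (cs.length v) (by omega) v a ?_ rfl
    by_cases he : Even j
    · simp only [he, if_true] at hbig hsmall
      rcases ha with rfl | rfl <;> assumption
    · simp only [he, if_false] at hbig hsmall
      rcases ha with rfl | rfl <;> assumption
  have hjm : M s t = 0 ∨ j + 1 ≤ M s t := by
    by_contra! h
    have hred : cs.IsReduced (alternatingWord t s (j + 1)) := by
      unfold CoxeterSystem.IsReduced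
      rw [length_alternatingWord]
      refine le_antisymm ((cs.length_wordProd_le _).trans (by simp)) ?_
      have h1 := cs.not_isRightDescent_iff.1 hs
      have h2 : w * cs.simple s = v * cs.wordProd (alternatingWord t s (j + 1)) := by
        rw [alternatingWord_succ, wordProd_concat, ← mul_assoc, ← hv]
      have h3 := cs.length_mul_le v (cs.wordProd (alternatingWord t s (j + 1)))
      rw [← h2] at h3
      omega
    exact cs.not_isReduced_alternatingWord t s (by rw [M.symmetric]; exact h.1)
      (by rw [M.symmetric]; omega) hred
  rw [hv, map_mul, LinearEquiv.mul_apply, geomRep_alternatingWord_single M hst]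
  simp only [map_add, map_smul, Pi.add_apply, Pi.smul_apply, smul_eq_mul]
  refine add_nonneg (mul_nonneg (dihedralCoeff_nonneg hjm) (hpos _ ?_))
    (mul_nonneg (dihedralCoeff_nonneg (hjm.imp_right (by omega))) (hpos _ ?_))
  · split_ifs <;> simp
  · split_ifs <;> simp

/-- A non-trivial element of a Coxeter group makes some simple root negative. -/
theorem exists_geomRep_single_nonpos {w : M.Group} (hw : w ≠ 1) :
    ∃ s, ∀ r, geomRep M w (Pi.single s 1) r ≤ 0 := by
  set cs := M.toCoxeterSystem
  obtain ⟨s, hs⟩ := cs.exists_rightDescent_of_ne_one hw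
  refine ⟨s, fun r => ?_⟩
  have h := geomRep_single_nonneg M (w * cs.simple s) s
    (cs.isRightDescent_iff_not_isRightDescent_mul.1 hs) r
  rw [map_mul, LinearEquiv.mul_apply, geomRep_simple, simpleReflection_apply,
    cosForm_single_self] at h
  have e : (Pi.single s 1 - (2 : ℝ) • Pi.single s 1 : S → ℝ) = -Pi.single s 1 := by module
  rw [e, map_neg, Pi.neg_apply] at h
  linarith

end Tits

/-! ### Spherical Coxeter groups have positive definite forms -/

theorem cosineMatrix_eq_zero {S : Type*} (M : CoxeterMatrix S) {s t : S} (h : s ≠ t)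
    (hadj : ¬ (diagram M).Adj s t) :   cosineMatrix M s t = 0 := by
  have : M s t = 2 := by
    by_contra h2
    exact hadj ⟨h, h2⟩
  simp [cosineMatrix, this]

section Spherical

variable {S : Type*} [Fintype S] [DecidableEq S] (M : CoxeterMatrix S)

/-- The form `B` of a finite Coxeter group is positive definite. For an invariant inner product `G`,
each simple reflection is an orthogonal reflection, so `B(e_s, x) = 2 G(e_s, x) / G(e_s, e_s)`. As
`B` is symmetric, `G(e_s, e_s) = G(e_t, e_t)` whenever `B(e_s, e_t) ≠ 0`; thus `B` is `2 G`
up to rescaling the basis vectors. -/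
theorem cosForm_pos_of_finite [Finite M.Group] {v : S → ℝ} (hv : v ≠ 0) : 0 < cosForm M v v := by
  have := Fintype.ofFinite M.Group
  let D : LinearMap.BilinForm ℝ (S → ℝ) := Matrix.toBilin' (1 : Matrix S S ℝ)
  have hD (x y : S → ℝ) : D x y = ∑ i, x i * y i := by
    simp [D, Matrix.toBilin'_apply']; rfl
  let G : LinearMap.BilinForm ℝ (S → ℝ) :=
    ∑ w : M.Group, D.compl₁₂ (geomRep M w).toLinearMap (geomRep M w).toLinearMap
  have hG (x y : S → ℝ) : G x y = ∑ w : M.Group, D (geomRep M w x) (geomRep M w y) := by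
    simp [G, LinearMap.sum_apply]
  have hsymm (x y : S → ℝ) : G x y = G y x := by
    simp only [hG, hD, mul_comm]
  have hinv (u : M.Group) (x y : S → ℝ) : G (geomRep M u x) (geomRep M u y) = G x y := by
    rw [hG, hG]
    refine Fintype.sum_equiv (Equiv.mulRight u) _ _ fun w => ?_
    simp [map_mul, LinearEquiv.mul_apply]
  have hpos {x : S → ℝ} (hx : x ≠ 0) : 0 < G x x := by
    rw [hG]
    refine Finset.sum_pos (fun w _ => ?_) ⟨1, Finset.mem_univ _⟩
    have h1 : geomRep M w x ≠ 0 := by simpa using hx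
    obtain ⟨i, hi⟩ := Function.ne_iff.1 h1
    rw [hD]
    exact Finset.sum_pos' (fun j _ => mul_self_nonneg _) ⟨i, Finset.mem_univ i, by
      exact mul_self_pos.2 hi⟩
  set g : S → ℝ := fun s => G (Pi.single s 1) (Pi.single s 1) with hg
  have hgpos (s : S) : 0 < g s := hpos (by simp)
  have horth (s : S) (x : S → ℝ) :
      2 * G (Pi.single s 1) x = g s * cosForm M (Pi.single s 1) x := by
    have h := hinv (M.toCoxeterSystem.simple s) (Pi.single s 1) x
    simp only [geomRep_simple, simpleReflection_apply, cosForm_single_self, map_sub, map_smul,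
      LinearMap.sub_apply, LinearMap.smul_apply, smul_eq_mul] at h
    simp only [hg]
    linarith
  have hA (s t : S) : cosineMatrix M s t =
      2 * (G (Pi.single s 1) (Pi.single t 1) / (Real.sqrt (g s) * Real.sqrt (g t))) := by
    have h1 := horth s (Pi.single t 1)
    have h2 := horth t (Pi.single s 1)
    rw [hsymm, cosForm_comm] at h2
    rw [cosForm_single] at h1 h2
    rcases eq_or_ne (cosineMatrix M s t) 0 with h0 | h0
    · rw [h0, mul_zero] at h1
      rw [h0]
      have : G (Pi.single s 1) (Pi.single t 1) = 0 := by linarith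
      simp [this]
    · have he : g s = g t := mul_right_cancel₀ h0 (h1.symm.trans h2)
      have := (hgpos t).ne'
      rw [he, Real.mul_self_sqrt (hgpos t).le, ← mul_div_assoc, h1, he]
      field_simp
  set u : S → ℝ := fun s => v s / Real.sqrt (g s) with hu
  have hu0 : u ≠ 0 := by
    obtain ⟨s, hs⟩ := Function.ne_iff.1 hv
    refine Function.ne_iff.2 ⟨s, ?_⟩
    exact div_ne_zero hs (Real.sqrt_pos.2 (hgpos s)).ne'
  have hGu : G u u = ∑ s, ∑ t, u s * G (Pi.single s 1) (Pi.single t 1) * u t := by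
    conv_lhs => rw [← Matrix.toBilin'_toMatrix' G]
    rw [Matrix.toBilin'_apply]
    simp [LinearMap.BilinForm.toMatrix'_apply]
  have : cosForm M v v = 2 * G u u := by
    rw [cosForm_apply, hGu, Finset.mul_sum]
    refine Finset.sum_congr rfl fun s _ => ?_
    rw [Finset.mul_sum]
    refine Finset.sum_congr rfl fun t _ => ?_
    rw [hA]
    simp only [hu]
    ring
  rw [this]
  have := hpos hu0
  linarith

theorem cosForm_restrict (p : S → Prop) [DecidablePred p] (v : S → ℝ) (hv : ∀ s, ¬ p s → v s = 0) :
    cosForm M v v = cosForm (restrict M p) (fun s => v s) (fun s => v s) := by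
  have key (f : S → ℝ) (hf : ∀ s, ¬ p s → f s = 0) : ∑ s, f s = ∑ s : {s // p s}, f s := by
    rw [← Finset.sum_subtype (Finset.univ.filter p) (by simp) f, Finset.sum_filter]
    exact Finset.sum_congr rfl fun s _ => by by_cases h : p s <;> simp [h, hf]
  rw [cosForm_apply, cosForm_apply, key _ (fun s hs => by simp [hv s hs])]
  refine Finset.sum_congr rfl fun s _ => ?_
  rw [key _ (fun t ht => by simp [hv t ht])]
  rfl

/-- The form of a spherical Coxeter group is the orthogonal sum of those of its components. -/
theorem cosForm_pos_of_isSpherical (hM : IsSpherical M) {v : S → ℝ} (hv : v ≠ 0) :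
    0 < cosForm M v v := by
  classical
  let c : S → (diagram M).ConnectedComponent := (diagram M).connectedComponentMk
  let V : (diagram M).ConnectedComponent → S → ℝ := fun k s => if c s = k then v s else 0
  have := Fintype.ofFinite (diagram M).ConnectedComponent
  have hsum : cosForm M v v = ∑ k, cosForm M (V k) (V k) := by
    simp only [cosForm_apply]
    rw [Finset.sum_comm (s := Finset.univ (α := (diagram M).ConnectedComponent))]
    refine Finset.sum_congr rfl fun s _ => ?_
    rw [Finset.sum_comm (s := Finset.univ (α := (diagram M).ConnectedComponent))]
    refine Finset.sum_congr rfl fun t _ => ?_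
    simp only [V]
    rw [Finset.sum_eq_single (c s)]
    · by_cases h : c t = c s
      · simp [h]
      · have hst : s ≠ t := fun e => h (by rw [e])
        have : ¬ (diagram M).Adj s t := fun hadj =>
          h (SimpleGraph.ConnectedComponent.sound hadj.symm.reachable)
        simp [cosineMatrix_eq_zero M hst this]
    · intro k _ hk
      simp [hk.symm]
    · simp
  have hterm (k : (diagram M).ConnectedComponent) (hk : V k ≠ 0) :
      0 < cosForm M (V k) (V k) := by
    have hfin := hM k
    rw [cosForm_restrict M (· ∈ k.supp) (V k) (fun s hs => if_neg hs)]
    apply cosForm_pos_of_finite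
    obtain ⟨s, hs⟩ := Function.ne_iff.1 hk
    have hsk : c s = k := by
      by_contra h
      exact hs (if_neg h)
    exact Function.ne_iff.2 ⟨⟨s, hsk⟩, hs⟩
  rw [hsum]
  obtain ⟨s, hs⟩ := Function.ne_iff.1 hv
  refine Finset.sum_pos' (fun k _ => ?_) ⟨c s, Finset.mem_univ _, hterm _ ?_⟩
  · by_cases hk : V k = 0
    · simp [hk]
    · exact (hterm k hk).le
  · refine Function.ne_iff.2 ⟨s, ?_⟩
    simpa [V] using hs

/-- The form is positive on the nonzero vectors with two zero coordinates: the principal submatrices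
of corank two are positive definite. -/
def IsTwoPositive : Prop :=
  ∀ v : S → ℝ, v ≠ 0 → ∀ s t, s ≠ t → v s = 0 → v t = 0 → 0 < cosForm M v v

theorem IsTwoPerfect.isTwoPositive (hM : IsTwoPerfect M) : IsTwoPositive M := by
  classical
  intro v hv s t hst hs ht
  rw [cosForm_restrict M (· ≠ s) v (fun r hr => by rw [not_not.1 hr, hs]),
    cosForm_restrict (restrict M (· ≠ s)) (· ≠ ⟨t, hst.symm⟩) _
      (fun r hr => by rw [not_not.1 hr, ht])]
  refine cosForm_pos_of_isSpherical _ (hM s ⟨t, hst.symm⟩) ?_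
  obtain ⟨r, hr⟩ := Function.ne_iff.1 hv
  refine Function.ne_iff.2 ⟨⟨⟨r, ?_⟩, ?_⟩, hr⟩
  · rintro rfl; exact hr hs
  · intro h
    have : r = t := congrArg Subtype.val h
    exact hr (this ▸ ht)

end Spherical

/-! ### Positive semidefinite forms and growth -/

section FreeSemigroup

theorem reduce_map_true {X : Type*} [DecidableEq X] (l : List X) :
    FreeGroup.reduce (l.map fun x => (x, true)) = l.map fun x => (x, true) := by
  induction l with
  | nil => rfl
  | cons a l ih =>
    rw [List.map_cons, FreeGroup.reduce.cons, ih]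
    cases l <;> simp

theorem freeGroup_prod_map_of_injective {X : Type*} :
    Function.Injective fun l : List X => (l.map FreeGroup.of).prod := by
  classical
  have h (l : List X) : (l.map FreeGroup.of).prod = FreeGroup.mk (l.map fun x => (x, true)) := by
    induction l with
    | nil => rfl
    | cons a l ih =>
      rw [List.map_cons, List.prod_cons, ih, List.map_cons]
      rfl
  intro l l' hl
  have h1 : (FreeGroup.mk (l.map fun x => (x, true))).toWord =
      (FreeGroup.mk (l'.map fun x => (x, true))).toWord := by
    rw [← h, ← h]; exact congrArg _ hl
  rw [FreeGroup.toWord_mk, FreeGroup.toWord_mk, reduce_map_true, reduce_map_true] at h1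
  exact List.map_injective_iff.2 (fun a b hab => (Prod.ext_iff.1 hab).1) h1

/-- A large group contains a free semigroup of rank two. -/
theorem IsLargeGroup.exists_free_semigroup {G : Type*} [Group G] (hG : IsLargeGroup G) :
    ∃ h : Bool → G, Function.Injective fun l : List Bool => (l.map h).prod := by
  obtain ⟨H, -, X, _, f, hf⟩ := hG
  obtain ⟨a, b, hab⟩ := exists_pair_ne X
  choose g hg using hf
  let x : Bool → X := fun i => if i then a else b
  have hx : Function.Injective x := by
    intro i j hij
    cases i <;> cases j <;> simp_all [x, hab.symm]
  refine ⟨fun i => (g (FreeGroup.of (x i)) : G), fun l l' hl => ?_⟩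
  have h1 (l : List Bool) : (l.map fun i => (g (FreeGroup.of (x i)) : G)).prod =
      ((l.map fun i => g (FreeGroup.of (x i))).prod : H) := by
    rw [Subgroup.val_list_prod, List.map_map]; rfl
  simp only [h1] at hl
  have h2 := congrArg f (Subtype.ext hl)
  simp only [map_list_prod, List.map_map] at h2
  have h3 (l : List Bool) : l.map (f ∘ fun i => g (FreeGroup.of (x i))) =
      (l.map x).map FreeGroup.of := by
    simp [List.map_map, Function.comp_def, hg]
  rw [h3, h3] at h2
  exact List.map_injective_iff.2 hx (freeGroup_prod_map_of_injective h2)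

end FreeSemigroup

section Growth

variable {S : Type*} [Fintype S] [DecidableEq S] (M : CoxeterMatrix S)

/-- Let `f` be the sum of the coordinates. If `B(v, v) = ∑ (R v)_i²`, then `f ∘ w - f = B(v, ·)`
for some `v` with `R v` bounded by the length of `w`: the orbit of `f` grows at most linearly. -/
theorem exists_displacement (R : (S → ℝ) →ₗ[ℝ] (S → ℝ))
    (hR : ∀ v w, cosForm M v w = ∑ i, R v i * R w i) (w : M.Group) :
    ∃ v : S → ℝ, (∀ x, ∑ i, geomRep M w x i - ∑ i, x i = cosForm M v x) ∧
      ∀ i, |R v i| ≤ 2 * M.toCoxeterSystem.length w := by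
  set cs := M.toCoxeterSystem
  have hroot (u : M.Group) (s : S) (i : S) : |R (geomRep M u (Pi.single s 1)) i| ≤ 2 := by
    have h1 := cosForm_geomRep M u (Pi.single s 1) (Pi.single s 1)
    rw [cosForm_single_self, hR] at h1
    have h2 := Finset.single_le_sum (f := fun i => R (geomRep M u (Pi.single s 1)) i *
      R (geomRep M u (Pi.single s 1)) i) (fun i _ => mul_self_nonneg _) (Finset.mem_univ i)
    apply abs_le_of_sq_le_sq _ (by norm_num)
    nlinarith
  have key (ω : List S) : ∃ v : S → ℝ,
      (∀ x, ∑ i, geomRep M (cs.wordProd ω) x i - ∑ i, x i = cosForm M v x) ∧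
        ∀ i, |R v i| ≤ 2 * ω.length := by
    induction ω with
    | nil => exact ⟨0, by simp, by simp⟩
    | cons s ω ih =>
      obtain ⟨v, hv, hb⟩ := ih
      refine ⟨v - geomRep M (cs.wordProd ω)⁻¹ (Pi.single s 1), fun x => ?_, fun i => ?_⟩
      · rw [map_sub, LinearMap.sub_apply, ← hv, cosForm_geomRep_inv, cs.wordProd_cons, map_mul,
          LinearEquiv.mul_apply, geomRep_simple, simpleReflection_apply]
        simp [Finset.sum_sub_distrib, Pi.single_apply]
        ring
      · rw [map_sub, Pi.sub_apply, List.length_cons]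
        have h1 := hroot (cs.wordProd ω)⁻¹ s i
        have h2 := hb i
        have h3 := abs_sub (R v i) (R (geomRep M (cs.wordProd ω)⁻¹ (Pi.single s 1)) i)
        push_cast
        linarith
  obtain ⟨ω, hω, rfl⟩ := cs.exists_isReduced w
  obtain ⟨v, h1, h2⟩ := key ω
  exact ⟨v, h1, by rw [hω.eq]; exact h2⟩

/-- If the form of a Coxeter group is positive semidefinite, the group is not large: by Tits's
theorem the orbit of a point in the open fundamental chamber is uniformly discrete for
the (semi-)Euclidean metric, so the group has polynomial growth and contains no free semigroup of
rank two. -/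
theorem not_isLargeGroup_of_posSemidef (hM : ∀ v, 0 ≤ cosForm M v v) : ¬ IsLargeGroup M.Group := by
  intro hlarge
  obtain ⟨h, hinj⟩ := hlarge.exists_free_semigroup
  set cs := M.toCoxeterSystem
  obtain ⟨R₀, hR₀⟩ : ∃ R₀ : Matrix S S ℝ, Matrix.of (cosineMatrix M) = R₀.conjTranspose * R₀ := by
    have : (Matrix.of (cosineMatrix M)).PosSemidef := by
      refine Matrix.PosSemidef.of_dotProduct_mulVec_nonneg ?_ fun x => ?_
      · ext s t
        simp [cosineMatrix_symm M s t]
      · have := hM x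
        rwa [cosForm, Matrix.toBilin'_apply'] at this
    open scoped MatrixOrder in
    exact CStarAlgebra.nonneg_iff_eq_star_mul_self.1 this.nonneg
  set R : (S → ℝ) →ₗ[ℝ] (S → ℝ) := Matrix.toLin' R₀
  have hR (v w : S → ℝ) : cosForm M v w = ∑ i, R v i * R w i := by
    rw [cosForm, Matrix.toBilin'_apply', hR₀, ← Matrix.mulVec_mulVec, Matrix.dotProduct_mulVec,
      Matrix.conjTranspose_eq_transpose_of_trivial, Matrix.vecMul_transpose]
    rfl
  choose v hv hb using exists_displacement M R hR
  -- distinct orbit points have distance at least `1/√2`, tested against the root made negative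
  have hsep (w w' : M.Group) (hww : w ≠ w') :
      1 / 2 ≤ ∑ i, (R (v w') i - R (v w) i) ^ 2 := by
    have hu : w' * w⁻¹ ≠ 1 := fun h => hww (mul_inv_eq_one.1 h).symm
    obtain ⟨s, hs⟩ := exists_geomRep_single_nonpos M hu
    set x := geomRep M w⁻¹ (Pi.single s 1) with hx
    have h1 := hv w' x
    have h2 := hv w x
    have h3 : geomRep M w x = Pi.single s 1 := by
      rw [hx, ← LinearEquiv.mul_apply, ← map_mul]; simp
    have h4 : geomRep M w' x = geomRep M (w' * w⁻¹) (Pi.single s 1) := by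
      rw [hx, map_mul, LinearEquiv.mul_apply]
    have h5 : ∑ i, geomRep M w' x i ≤ 0 := by
      rw [h4]; exact Finset.sum_nonpos fun i _ => hs i
    have h6 : ∑ i, geomRep M w x i = 1 := by rw [h3]; simp
    have h7 : cosForm M (v w' - v w) x ≤ -1 := by
      rw [map_sub, LinearMap.sub_apply]; linarith
    have h8 : ∑ i, R x i ^ 2 = 2 := by
      have := cosForm_geomRep M w⁻¹ (Pi.single s 1) (Pi.single s 1)
      rw [cosForm_single_self, hR] at this
      simpa only [pow_two] using this
    have h9 := Finset.sum_mul_sq_le_sq_mul_sq Finset.univ (R (v w' - v w)) (R x)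
    rw [h8, ← hR] at h9
    have h10 : 1 ≤ cosForm M (v w' - v w) x ^ 2 := by nlinarith
    simp only [map_sub, Pi.sub_apply] at h9 h10 ⊢
    linarith
  set n := Fintype.card S with hn
  -- the cell of `R (v w)` in a cubical grid of mesh `1 / (2 n)` determines `w`
  let cell : M.Group → S → ℤ := fun w i => ⌊R (v w) i * (2 * n)⌋
  have hcell : Function.Injective cell := by
    intro w w' hww
    by_contra hne
    have h1 := hsep w w' hne
    have hn0 : (0 : ℝ) < n := by
      rw [hn]
      by_contra h0
      have : Fintype.card S = 0 := by
        have : (Fintype.card S : ℝ) ≤ 0 := not_lt.1 h0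
        exact Nat.le_zero.1 (by exact_mod_cast this)
      have := Fintype.card_eq_zero_iff.1 this
      simp at h1
      norm_num at h1
    have h2 : ∀ i ∈ Finset.univ, (R (v w') i - R (v w) i) ^ 2 ≤ (1 / (2 * n : ℝ)) ^ 2 := by
      intro i _
      have h3 := Int.abs_sub_lt_one_of_floor_eq_floor (congrFun hww i)
      rw [← sub_mul, abs_mul, abs_of_pos (by positivity : (0 : ℝ) < 2 * n),
        ← lt_div_iff₀ (by positivity), abs_sub_comm] at h3
      rw [← sq_abs]
      gcongr
    have h4 := Finset.sum_le_sum h2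
    rw [Finset.sum_const, Finset.card_univ, ← hn, nsmul_eq_mul] at h4
    have h5 : (n : ℝ) * (1 / (2 * n)) ^ 2 = 1 / (4 * n) := by field_simp; norm_num
    have h6 : (1 : ℝ) ≤ n := by
      have : 0 < n := by exact_mod_cast hn0
      exact_mod_cast this
    have h7 : 1 / (4 * n : ℝ) < 1 / 2 := by
      rw [div_lt_div_iff₀ (by positivity) (by norm_num)]; linarith
    linarith
  set L := max (cs.length (h true)) (cs.length (h false)) with hL
  have hlen (l : List Bool) : cs.length (l.map h).prod ≤ L * l.length := by
    induction l with
    | nil => simp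
    | cons i l ih =>
      rw [List.map_cons, List.prod_cons, List.length_cons]
      refine (cs.length_mul_le _ _).trans ?_
      have : cs.length (h i) ≤ L := by cases i <;> simp [hL]
      rw [mul_add, mul_one]; omega
  have hcount (r : ℕ) : (2 : ℕ) ^ r ≤ (8 * n * L * r + 3) ^ n := by
    let K : ℤ := 4 * n * L * r + 1
    have hmem (l : Fin r → Bool) (i : S) :
        cell ((List.ofFn l).map h).prod i ∈ Finset.Icc (-K) K := by
      set w := ((List.ofFn l).map h).prod
      have h1 : (cs.length w : ℝ) ≤ L * r := by
        have := hlen (List.ofFn l)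
        rw [List.length_ofFn] at this
        exact_mod_cast this
      have h2 : |R (v w) i * (2 * n)| ≤ 4 * n * L * r := by
        rw [abs_mul, abs_of_nonneg (by positivity : (0 : ℝ) ≤ 2 * n)]
        calc |R (v w) i| * (2 * n) ≤ (2 * (L * r)) * (2 * n) := by
              gcongr
              exact (hb w i).trans (by linarith)
          _ = 4 * n * L * r := by ring
      obtain ⟨h3, h4⟩ := abs_le.1 h2
      rw [Finset.mem_Icc]
      constructor
      · rw [Int.le_floor]
        push_cast [K]; linarith
      · have : ((cell w i : ℤ) : ℝ) ≤ (K : ℤ) := by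
          refine (Int.floor_le _).trans ?_
          push_cast [K]; linarith
        exact_mod_cast this
    let F : (Fin r → Bool) → (S → Finset.Icc (-K) K) := fun l i => ⟨_, hmem l i⟩
    have hF : Function.Injective F := by
      intro l l' hl
      apply List.ofFn_injective
      apply hinj
      apply hcell
      funext i
      exact congrArg Subtype.val (congrFun hl i)
    have h1 := Fintype.card_le_of_injective F hF
    simp only [Fintype.card_fun, Fintype.card_bool, Fintype.card_fin, Fintype.card_coe,
      Int.card_Icc] at h1
    convert h1 using 2
    simp only [K]
    have : (4 * n * L * r + 1 + 1 - -(4 * n * L * r + 1) : ℤ) = ((8 * n * L * r + 3 : ℕ) : ℤ) := by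
      push_cast; ring
    rw [this, Int.toNat_natCast]
  have hlim := tendsto_pow_const_div_const_pow_of_one_lt n (one_lt_two (α := ℝ))
  set c : ℝ := 8 * n * L + 3 with hc
  have hc0 : 0 < c := by positivity
  have hlim2 := hlim.const_mul (c ^ n)
  rw [mul_zero] at hlim2
  obtain ⟨r, hr1, hr0⟩ := ((hlim2.eventually (gt_mem_nhds one_pos)).and
    (Filter.eventually_ge_atTop 1)).exists
  have h1 : (2 : ℝ) ^ r ≤ (8 * n * L * r + 3) ^ n := by exact_mod_cast hcount r
  have hr0' : (1 : ℝ) ≤ r := by exact_mod_cast hr0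
  have h2 : (8 * n * L * r + 3 : ℝ) ^ n ≤ (c * r) ^ n := by
    gcongr
    rw [hc]; nlinarith
  rw [← mul_div_assoc, ← mul_pow, div_lt_one (by positivity)] at hr1
  linarith

end Growth

/-! ### The signature of the form -/

theorem cosineMatrix_nonpos {S : Type*} (M : CoxeterMatrix S) {s t : S} (h : s ≠ t) :
    cosineMatrix M s t ≤ 0 := by
  rcases (isCartanMatrix_cosineMatrix M).sign s t h with h | h
  · exact h.1.le
  · exact h.1.le

section Signature

variable {S : Type*} [Fintype S] [DecidableEq S] {M : CoxeterMatrix S}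

/-- Passing from `v` to its positive and negative parts does not increase the form. -/
theorem cosForm_posPart_add_negPart_le (v : S → ℝ) :
    cosForm M (fun s => max (v s) 0) (fun s => max (v s) 0) +
      cosForm M (fun s => max (-v s) 0) (fun s => max (-v s) 0) ≤ cosForm M v v := by
  set p : S → ℝ := fun s => max (v s) 0 with hp
  set q : S → ℝ := fun s => max (-v s) 0 with hq
  have hv : v = p - q := by
    funext s
    simp only [hp, hq, Pi.sub_apply]
    rcases le_total 0 (v s) with h | h
    · rw [max_eq_left h, max_eq_right (by linarith)]; ring
    · rw [max_eq_right h, max_eq_left (by linarith)]; ring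
  have hpq : cosForm M p q ≤ 0 := by
    rw [cosForm_apply]
    refine Finset.sum_nonpos fun s _ => Finset.sum_nonpos fun t _ => ?_
    have h1 : 0 ≤ p s := le_max_right _ _
    have h2 : 0 ≤ q t := le_max_right _ _
    rcases eq_or_ne s t with rfl | hst
    · have : p s * q s = 0 := by
        simp only [hp, hq]
        rcases le_total 0 (v s) with h | h
        · rw [max_eq_right (a := -v s) (by linarith), mul_zero]
        · rw [max_eq_right h, zero_mul]
      rw [mul_right_comm, this, zero_mul]
    · exact mul_nonpos_of_nonpos_of_nonneg
        (mul_nonpos_of_nonneg_of_nonpos h1 (cosineMatrix_nonpos M hst)) h2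
  have h3 := cosForm_comm M q p
  have h4 : cosForm M v v = cosForm M p p - 2 * cosForm M p q + cosForm M q q := by
    rw [hv]
    simp only [map_sub, LinearMap.sub_apply, h3]
    ring
  linarith

/-- A nonpositive vector with a zero coordinate has no other zero coordinate, and no change of
sign. -/
theorem mul_pos_of_cosForm_nonpos
    (hM : IsTwoPositive M)
    {v : S → ℝ} (hv0 : v ≠ 0) (hv : cosForm M v v ≤ 0) {s : S} (hs : v s = 0) {t t' : S}
    (ht : t ≠ s) (ht' : t' ≠ s) : 0 < v t * v t' := by
  have hne : ∀ t, t ≠ s → v t ≠ 0 := fun t ht h =>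
    absurd (hM v hv0 s t ht.symm hs h) (not_lt.2 hv)
  have key : ∀ t t', t ≠ s → t' ≠ s → 0 < v t → v t' < 0 → False := by
    intro t t' ht ht' h h'
    have h1 := hM (fun s => max (v s) 0) (Function.ne_iff.2 ⟨t, (lt_max_of_lt_left h).ne'⟩) s t'
      ht'.symm (by simp [hs]) (by simp [h'.le])
    have h2 := hM (fun s => max (-v s) 0)
      (Function.ne_iff.2 ⟨t', (lt_max_of_lt_left (neg_pos.2 h')).ne'⟩) s t
      ht.symm (by simp [hs]) (by simp [h.le])
    have h3 := cosForm_posPart_add_negPart_le (M := M) v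
    linarith
  rcases lt_or_gt_of_ne (hne t ht) with h | h <;> rcases lt_or_gt_of_ne (hne t' ht') with h' | h'
  · exact mul_pos_of_neg_of_neg h h'
  · exact (key t' t ht' ht h' h).elim
  · exact (key t t' ht ht' h h').elim
  · exact mul_pos h h'

/-- The form is not nonpositive on a plane. In such a plane, take `w₁` vanishing at `s` and `w₂`
vanishing at `t`; the combination of them vanishing at a third index has opposite signs at
`s` and `t`. -/
theorem not_cosForm_nonpos_of_independent
    (hM : IsTwoPositive M)
    (hcard : 2 < Fintype.card S) {x y : S → ℝ}
    (hxy : ∀ a b : ℝ, a • x + b • y = 0 → a = 0 ∧ b = 0)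
    (hq : ∀ a b : ℝ, cosForm M (a • x + b • y) (a • x + b • y) ≤ 0) : False := by
  obtain ⟨s, t, r, hst, hsr, htr⟩ := Fintype.two_lt_card_iff.1 hcard
  have hex (i : S) : ∃ a b : ℝ, a • x + b • y ≠ 0 ∧ (a • x + b • y) i = 0 := by
    rcases eq_or_ne (x i) 0 with h | h
    · exact ⟨1, 0, fun e => one_ne_zero (hxy _ _ e).1, by simp [h]⟩
    · refine ⟨y i, -x i, fun e => h (neg_eq_zero.1 (hxy _ _ e).2), ?_⟩
      simp only [Pi.add_apply, Pi.smul_apply, smul_eq_mul]; ring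
  obtain ⟨a₁, b₁, hw₁, hs⟩ := hex s
  obtain ⟨a₂, b₂, hw₂, ht⟩ := hex t
  have hq₁ := hq a₁ b₁
  have hq₂ := hq a₂ b₂
  have hq₃ (c c' : ℝ) : cosForm M (c • (a₁ • x + b₁ • y) - c' • (a₂ • x + b₂ • y))
      (c • (a₁ • x + b₁ • y) - c' • (a₂ • x + b₂ • y)) ≤ 0 := by
    have e : c • (a₁ • x + b₁ • y) - c' • (a₂ • x + b₂ • y) =
      (c * a₁ - c' * a₂) • x + (c * b₁ - c' * b₂) • y := by module
    rw [e]; exact hq _ _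
  generalize a₁ • x + b₁ • y = w₁ at *
  generalize a₂ • x + b₂ • y = w₂ at *
  have h1 := mul_pos_of_cosForm_nonpos hM hw₁ hq₁ hs hst.symm hsr.symm
  have h2 := mul_pos_of_cosForm_nonpos hM hw₂ hq₂ ht hst htr.symm
  have et : (w₂ r • w₁ - w₁ r • w₂) t = w₂ r * w₁ t := by simp [ht]
  have es : (w₂ r • w₁ - w₁ r • w₂) s = -(w₁ r * w₂ s) := by simp [hs]
  have h3 := mul_pos_of_cosForm_nonpos hM (v := w₂ r • w₁ - w₁ r • w₂) (s := r) (t := t) (t' := s)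
    (Function.ne_iff.2 ⟨t, by
      rw [et]; exact mul_ne_zero (right_ne_zero_of_mul h2.ne') (left_ne_zero_of_mul h1.ne')⟩)
    (hq₃ _ _) (by simp; ring) htr hsr
  rw [et, es] at h3
  nlinarith [mul_pos h1 h2]

/-- If the form is not positive semidefinite, but positive on all nonzero vectors with two
zero coordinates, then it is Lorentzian: it is the Gram matrix of a basis of `ℝ^(d,1)`. -/
theorem exists_lorentz_gram {d : ℕ} (hS : Fintype.card S = d + 1) (hd : 2 ≤ d)
    (hM : IsTwoPositive M)
    (hneg : ∃ v, cosForm M v v < 0) :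
    ∃ u : S → Fin (d + 1) → ℝ, (∀ s t, lorentzForm d (u s) (u t) = cosineMatrix M s t) ∧
      ∀ y, (∀ s, lorentzForm d (u s) y = 0) → y = 0 := by
  have hA : (Matrix.of (cosineMatrix M)).IsHermitian := by
    ext s t
    simp [cosineMatrix_symm M s t]
  set l : S → ℝ := hA.eigenvalues with hl
  let b : S → S → ℝ := fun i => (hA.eigenvectorBasis i).ofLp
  have horth (i j : S) : ∑ s, b i s * b j s = if i = j then 1 else 0 := by
    have h := orthonormal_iff_ite.1 hA.eigenvectorBasis.orthonormal i j
    rw [PiLp.inner_apply] at h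
    rw [← h]
    exact Finset.sum_congr rfl fun s _ => by simp [b, mul_comm]
  have hmul (i s : S) : ∑ t, cosineMatrix M s t * b i t = l i * b i s := by
    have h := congrFun (hA.mulVec_eigenvectorBasis i) s
    simpa [Matrix.mulVec, dotProduct, b] using h
  have hspec (s t : S) : cosineMatrix M s t = ∑ i, l i * (b i s * b i t) := by
    have h := congrFun (congrFun hA.spectral_theorem s) t
    simp only [Matrix.of_apply] at h
    rw [h]
    simp [Unitary.conjStarAlgAut_apply, Matrix.mul_apply, Matrix.diagonal_apply,
      Matrix.IsHermitian.eigenvectorUnitary_apply, b, hl]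
    exact Finset.sum_congr rfl fun i _ => by ring
  have hform (v : S → ℝ) (i : S) : cosForm M v (b i) = l i * ∑ s, v s * b i s := by
    rw [cosForm_apply, Finset.mul_sum]
    refine Finset.sum_congr rfl fun s _ => ?_
    simp_rw [mul_assoc]
    rw [← Finset.mul_sum, hmul]; ring
  obtain ⟨i₀, hi₀⟩ : ∃ i, l i < 0 := by
    by_contra! h
    obtain ⟨v, hv⟩ := hneg
    refine absurd hv (not_lt.2 ?_)
    have : cosForm M v v = ∑ i, l i * (∑ s, v s * b i s) ^ 2 := by
      rw [cosForm_apply]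
      simp_rw [hspec, pow_two, Finset.sum_mul_sum, Finset.mul_sum, Finset.sum_mul]
      conv_rhs => rw [Finset.sum_comm]
      refine Finset.sum_congr rfl fun s _ => ?_
      conv_rhs => rw [Finset.sum_comm]
      exact Finset.sum_congr rfl fun t _ => Finset.sum_congr rfl fun i _ => by ring
    rw [this]
    exact Finset.sum_nonneg fun i _ => mul_nonneg (h i) (sq_nonneg _)
  have hpos (j : S) (hj : j ≠ i₀) : 0 < l j := by
    by_contra! h
    refine not_cosForm_nonpos_of_independent hM (by omega) (x := b i₀) (y := b j)
      (fun p q hpq => ?_) (fun p q => ?_)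
    · have h1 (k : S) : p * (∑ s, b i₀ s * b k s) + q * ∑ s, b j s * b k s = 0 := by
        rw [Finset.mul_sum, Finset.mul_sum, ← Finset.sum_add_distrib]
        refine Finset.sum_eq_zero fun s _ => ?_
        have := congrFun hpq s
        simp only [Pi.add_apply, Pi.smul_apply, smul_eq_mul, Pi.zero_apply] at this
        linear_combination b k s * this
      have h2 := h1 i₀
      have h3 := h1 j
      simp only [horth, hj, hj.symm, if_true, if_false] at h2 h3
      constructor <;> linarith
    · simp only [map_add, map_smul, LinearMap.add_apply, LinearMap.smul_apply, hform, horth, hj,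
        hj.symm, if_true, if_false, smul_eq_mul]
      nlinarith [mul_nonneg (sq_nonneg p) (neg_nonneg.2 hi₀.le),
        mul_nonneg (sq_nonneg q) (neg_nonneg.2 h)]
  obtain ⟨e, he⟩ : ∃ e : Fin (d + 1) ≃ S, e (Fin.last d) = i₀ := by
    let e₀ : Fin (d + 1) ≃ S := (Fintype.equivFinOfCardEq hS).symm
    exact ⟨e₀.trans (Equiv.swap (e₀ (Fin.last d)) i₀), by simp⟩
  have hposc (k : Fin d) : 0 < l (e k.castSucc) := by
    refine hpos _ fun h => ?_
    rw [← he] at h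
    exact (Fin.castSucc_lt_last k).ne (e.injective h)
  refine ⟨fun s k => Real.sqrt |l (e k)| * b (e k) s, fun s t => ?_, fun y hy => ?_⟩
  · rw [hspec, ← e.sum_comp, Fin.sum_univ_castSucc, lorentzForm, sub_eq_add_neg]
    congr 1
    · refine Finset.sum_congr rfl fun k _ => ?_
      simp only [abs_of_pos (hposc k)]
      linear_combination b (e k.castSucc) s * b (e k.castSucc) t * Real.mul_self_sqrt (hposc k).le
    · simp only [he, abs_of_neg hi₀]
      linear_combination -(b i₀ s * b i₀ t) * Real.mul_self_sqrt (neg_pos.2 hi₀).le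
  · let c : Fin (d + 1) → ℝ := fun k =>
      (if k = Fin.last d then -1 else 1) * (Real.sqrt |l (e k)| * y k)
    have hsum (s : S) : ∑ k, c k * b (e k) s = 0 := by
      rw [← hy s, lorentzForm, Fin.sum_univ_castSucc, sub_eq_add_neg]
      congr 1
      · refine Finset.sum_congr rfl fun k _ => ?_
        simp only [c, (Fin.castSucc_lt_last k).ne, if_false]; ring
      · simp only [c, if_true]; ring
    funext k
    have h1 : ∑ s, (∑ k', c k' * b (e k') s) * b (e k) s = 0 :=
      Finset.sum_eq_zero fun s _ => by rw [hsum, zero_mul]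
    simp_rw [Finset.sum_mul, mul_assoc] at h1
    rw [Finset.sum_comm] at h1
    simp_rw [← Finset.mul_sum, horth] at h1
    simp only [EmbeddingLike.apply_eq_iff_eq, mul_ite, mul_one, mul_zero, Finset.sum_ite_eq',
      Finset.mem_univ, if_true] at h1
    have hlk : l (e k) ≠ 0 := by
      by_cases hk : e k = i₀
      · rw [hk]; exact hi₀.ne
      · exact (hpos _ hk).ne'
    have h2 : Real.sqrt |l (e k)| ≠ 0 := (Real.sqrt_pos.2 (abs_pos.2 hlk)).ne'
    have h3 : (if k = Fin.last d then (-1 : ℝ) else 1) ≠ 0 := by split_ifs <;> norm_num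
    exact (mul_eq_zero.1 ((mul_eq_zero.1 h1).resolve_left h3)).resolve_left h2

end Signature

/-! ### The number of edges of the diagram -/

theorem cosineMatrix_le_neg_one {S : Type*} (M : CoxeterMatrix S) {s t : S}
    (h : (diagram M).Adj s t) : cosineMatrix M s t ≤ -1 := by
  have h1 : M s t ≠ 1 := M.off_diagonal s t h.1
  have hc : 1 / 2 ≤ Real.cos (Real.pi / M s t) := by
    rcases eq_or_ne (M s t) 0 with h0 | h0
    · rw [h0]; norm_num
    · have h3 : 3 ≤ M s t := by have := h.2; omega
      have h3' : (3 : ℝ) ≤ M s t := by exact_mod_cast h3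
      have hpi := Real.pi_pos
      rw [← Real.cos_pi_div_three]
      apply Real.cos_le_cos_of_nonneg_of_le_pi (by positivity) (by linarith)
      exact div_le_div_of_nonneg_left hpi.le (by norm_num) h3'
  rw [cosineMatrix]; linarith

open Classical in
theorem sum_adj_eq_two_mul_card_edges {S : Type*} [Fintype S] (G : SimpleGraph S) :
    ∑ s, ∑ t, (if G.Adj s t then 1 else 0) = 2 * G.edgeFinset.card := by
  rw [← G.sum_degrees_eq_twice_card_edges]
  refine Finset.sum_congr rfl fun s _ => ?_
  rw [← G.card_neighborFinset_eq_degree, G.neighborFinset_eq_filter, Finset.card_filter]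

section EdgeCount

variable {S : Type*} [Fintype S] [DecidableEq S] {M : CoxeterMatrix S}

/-- There are no labels `∞`, since an edge with this label carries an isotropic vector. -/
theorem label_ne_zero (hcard : 4 ≤ Fintype.card S)
    (hM : IsTwoPositive M) (s t : S) :
    M s t ≠ 0 := by
  intro h0
  have hst : s ≠ t := by
    rintro rfl
    have := M.diagonal s
    change M s s = 1 at this
    omega
  have h2 : 1 < (Finset.univ \ {s, t} : Finset S).card := by
    have := Finset.le_card_sdiff ({s, t} : Finset S) Finset.univ
    rw [Finset.card_pair hst, Finset.card_univ] at this
    omega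
  obtain ⟨p, hp, q, hq, hpq⟩ := Finset.one_lt_card.1 h2
  simp only [Finset.mem_sdiff, Finset.mem_univ, true_and, Finset.mem_insert,
    Finset.mem_singleton, not_or] at hp hq
  have h3 := hM (Pi.single s 1 + Pi.single t 1) (Function.ne_iff.2 ⟨s, by simp [hst]⟩) p q hpq
    (by simp [hp.1, hp.2]) (by simp [hq.1, hq.2])
  have h4 : cosineMatrix M s t = -2 := by simp [cosineMatrix, h0]
  simp only [map_add, LinearMap.add_apply, cosForm_single, cosineMatrix_self,
    cosineMatrix_symm M t s, h4] at h3
  norm_num at h3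

/-- The subgraph of the diagram obtained by deleting all edges at two nodes `p` and `q`. -/
def diagramAvoiding (M : CoxeterMatrix S) (p q : S) : SimpleGraph S where
  Adj s t := (diagram M).Adj s t ∧ (s ≠ p ∧ s ≠ q) ∧ (t ≠ p ∧ t ≠ q)
  symm := ⟨fun _ _ h => ⟨h.1.symm, h.2.2, h.2.1⟩⟩
  loopless := ⟨fun _ h => h.1.1 rfl⟩

open Classical in
/-- A positive definite form on `k` nodes has fewer than `k` edges: it is positive at `(1, …, 1)`,
and each edge contributes at most `-2`. -/
theorem card_edges_diagramAvoiding_lt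
    (hM : IsTwoPositive M)
    (hcard : 3 ≤ Fintype.card S) {p q : S} (hpq : p ≠ q) :
    (diagramAvoiding M p q).edgeFinset.card + 3 ≤ Fintype.card S := by
  set v : S → ℝ := fun s => if s ≠ p ∧ s ≠ q then 1 else 0 with hv
  have hfil : (Finset.univ.filter fun s => s ≠ p ∧ s ≠ q).card + 2 = Fintype.card S := by
    have : (Finset.univ.filter fun s => s ≠ p ∧ s ≠ q) = Finset.univ \ {p, q} := by
      ext s; simp
    rw [this, Finset.card_sdiff_of_subset (Finset.subset_univ _), Finset.card_pair hpq,
      Finset.card_univ]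
    omega
  have hsum : ∑ s, v s + 2 = Fintype.card S := by
    rw [hv, Finset.sum_boole]
    exact_mod_cast hfil
  have hv0 : v ≠ 0 := by
    intro h
    rw [h] at hsum
    simp only [Pi.zero_apply, Finset.sum_const_zero, zero_add] at hsum
    have : Fintype.card S = 2 := by exact_mod_cast hsum.symm
    omega
  have h1 := hM v hv0 p q hpq (by simp [hv]) (by simp [hv])
  have h2 : cosForm M v v ≤
      ∑ s, ∑ t, (2 * (if s = t then v s else 0) -
        (if (diagramAvoiding M p q).Adj s t then (1 : ℝ) else 0)) := by
    rw [cosForm_apply]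
    refine Finset.sum_le_sum fun s _ => Finset.sum_le_sum fun t _ => ?_
    by_cases hs : s ≠ p ∧ s ≠ q
    · by_cases ht : t ≠ p ∧ t ≠ q
      · have e1 : v s = 1 := if_pos hs
        have e2 : v t = 1 := if_pos ht
        rw [e1, e2]
        rcases eq_or_ne s t with rfl | hst
        · simp [cosineMatrix_self]
        · by_cases hadj : (diagram M).Adj s t
          · rw [if_pos (show (diagramAvoiding M p q).Adj s t from ⟨hadj, hs, ht⟩), if_neg hst]
            linarith [cosineMatrix_le_neg_one M hadj]
          · have hadj' : ¬ (diagramAvoiding M p q).Adj s t := fun h => hadj h.1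
            simp [hadj', hst, cosineMatrix_eq_zero M hst hadj]
      · have e2 : v t = 0 := if_neg ht
        have hadj : ¬ (diagramAvoiding M p q).Adj s t := fun h => ht h.2.2
        rcases eq_or_ne s t with rfl | hst
        · exact absurd hs ht
        · simp [e2, hadj, hst]
    · have e1 : v s = 0 := if_neg hs
      have hadj : ¬ (diagramAvoiding M p q).Adj s t := fun h => hs h.2.1
      simp [e1, hadj]
  have h3 : ∑ s, ∑ t, (2 * (if s = t then v s else 0) -
        (if (diagramAvoiding M p q).Adj s t then (1 : ℝ) else 0)) =
      2 * ∑ s, v s - 2 * (diagramAvoiding M p q).edgeFinset.card := by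
    have h4 := sum_adj_eq_two_mul_card_edges (diagramAvoiding M p q)
    have h5 : ∑ s, ∑ t, (if (diagramAvoiding M p q).Adj s t then (1 : ℝ) else 0) =
        2 * (diagramAvoiding M p q).edgeFinset.card := by
      exact_mod_cast h4
    simp_rw [Finset.sum_sub_distrib]
    rw [h5]
    simp [← Finset.mul_sum]
  have h6 : ((diagramAvoiding M p q).edgeFinset.card : ℝ) + 2 < Fintype.card S := by linarith
  have h7 : (diagramAvoiding M p q).edgeFinset.card + 2 < Fintype.card S := by exact_mod_cast h6
  omega

/-- Counting the edges off a pair of nodes, over all pairs, gives `e₊ ≤ d + 2`. -/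
theorem edgeCount_le {d : ℕ} (hS : Fintype.card S = d + 1) (hd : 4 ≤ d)
    (hM : IsTwoPositive M) :
    edgeCount M ≤ d + 2 := by
  classical
  have he : edgeCount M = (diagram M).edgeFinset.card := by
    rw [edgeCount, ← SimpleGraph.coe_edgeFinset, Set.ncard_coe_finset]
  have hle : ∑ x ∈ (Finset.univ : Finset S).offDiag,
      2 * (diagramAvoiding M x.1 x.2).edgeFinset.card ≤ (d * (d + 1)) * (2 * (d - 2)) := by
    refine (Finset.sum_le_card_nsmul _ _ (2 * (d - 2)) fun x hx => ?_).trans (le_of_eq ?_)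
    · have := card_edges_diagramAvoiding_lt hM (by omega) (Finset.mem_offDiag.1 hx).2.2
      omega
    · rw [Finset.offDiag_card, Finset.card_univ, hS, smul_eq_mul]
      congr 1
      rw [Nat.sub_eq_iff_eq_add (by nlinarith)]; ring
  have heq : ∑ x ∈ (Finset.univ : Finset S).offDiag,
      2 * (diagramAvoiding M x.1 x.2).edgeFinset.card =
        2 * edgeCount M * ((d - 1) * (d - 2)) := by
    simp_rw [← sum_adj_eq_two_mul_card_edges]
    rw [Finset.sum_comm, he, ← sum_adj_eq_two_mul_card_edges, Finset.sum_mul]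
    refine Finset.sum_congr rfl fun s _ => ?_
    rw [Finset.sum_comm, Finset.sum_mul]
    refine Finset.sum_congr rfl fun t _ => ?_
    by_cases hadj : (diagram M).Adj s t
    · have hfil : ((Finset.univ : Finset S).offDiag.filter
          fun x => (diagramAvoiding M x.1 x.2).Adj s t) = (Finset.univ \ {s, t}).offDiag := by
        ext ⟨p, q⟩
        simp only [diagramAvoiding, hadj, Finset.mem_filter, Finset.mem_offDiag, Finset.mem_univ,
          Finset.mem_sdiff, Finset.mem_insert, Finset.mem_singleton]
        grind
      rw [← Finset.card_filter, hfil, if_pos hadj, one_mul, Finset.offDiag_card,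
        Finset.card_sdiff_of_subset (Finset.subset_univ _), Finset.card_pair hadj.1,
        Finset.card_univ, hS]
      obtain ⟨k, rfl⟩ : ∃ k, d = k + 2 := ⟨d - 2, by omega⟩
      simp only [show k + 2 + 1 - 2 = k + 1 by omega, show k + 2 - 1 = k + 1 by omega,
        show k + 2 - 2 = k by omega]
      rw [Nat.sub_eq_iff_eq_add (by nlinarith)]; ring
    · rw [if_neg hadj, zero_mul]
      exact Finset.sum_eq_zero fun x _ => if_neg fun h => hadj h.1
  rw [heq] at hle
  obtain ⟨k, rfl⟩ : ∃ k, d = k + 2 := ⟨d - 2, by omega⟩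
  simp only [show k + 2 - 1 = k + 1 by omega, show k + 2 - 2 = k by omega] at hle
  have hk : 0 < 2 * k := by omega
  have h1 : edgeCount M * (k + 1) ≤ (k + 2) * (k + 2 + 1) := by
    refine le_of_mul_le_mul_right ?_ hk
    calc edgeCount M * (k + 1) * (2 * k) = 2 * edgeCount M * ((k + 1) * k) := by ring
      _ ≤ _ := hle
  by_contra! h
  have : (k + 2 + 3) * (k + 1) ≤ edgeCount M * (k + 1) := Nat.mul_le_mul_right _ h
  nlinarith

end EdgeCount

/-! ### Cochains on the diagram and their integrals over circuits -/

section Rotation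

theorem finRotate_rev_finRotate {k : ℕ} (i : Fin k) :
    finRotate k (finRotate k i).rev = i.rev := by
  obtain ⟨n, rfl⟩ : ∃ n, k = n + 1 := ⟨k - 1, by have := i.isLt; omega⟩
  rcases eq_or_ne i (Fin.last n) with rfl | h
  · rw [finRotate_last]; simp
  · have h1 := coe_finRotate_of_ne_last h
    have h2 : (finRotate (n + 1) i).rev ≠ Fin.last n := by
      intro h2
      have := congrArg Fin.val h2
      rw [Fin.val_rev, h1, Fin.val_last] at this
      omega
    ext
    rw [coe_finRotate_of_ne_last h2, Fin.val_rev, Fin.val_rev, h1]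
    have : (i : ℕ) ≠ n := fun e => h (Fin.ext e)
    have := i.isLt
    omega

/-- The cyclic product of the opposite circuit is that of the transposed matrix. -/
theorem cyclicProduct_rev {S : Type*} (A : S → S → ℝ) {k : ℕ} (c : Fin k → S) :
    cyclicProduct A (c ∘ Fin.rev) = ∏ i, A (c (finRotate k i)) (c i) := by
  unfold cyclicProduct
  refine Fintype.prod_equiv ((finRotate k).trans Fin.revPerm) _ _ fun i => ?_
  rw [Equiv.trans_apply, Fin.revPerm_apply, finRotate_rev_finRotate]
  rfl

end Rotation

section Exactness

variable {S : Type*} {G : SimpleGraph S}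

/-- An antisymmetric function on the edges of a connected graph whose integral over every cycle
vanishes is a gradient. The potential is obtained by integration along a spanning tree; each other
edge closes a path of the tree to a cycle. -/
theorem exists_potential [Nonempty S] (hG : G.Connected) {x : S → S → ℝ}
    (hx : ∀ s t, x t s = -x s t)
    (hcyc : ∀ k, 3 ≤ k → ∀ c : Fin k → S, Function.Injective c →
      (∀ i, G.Adj (c i) (c (finRotate k i))) → ∑ i, x (c i) (c (finRotate k i)) = 0) :
    ∃ f : S → ℝ, ∀ s t, G.Adj s t → x s t = f t - f s := by
  obtain ⟨T, hTG, hT⟩ := hG.exists_isTree_le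
  have r : S := Classical.arbitrary S
  choose p hp _ using fun v => hT.existsUnique_path r v
  let f : S → ℝ := fun v => ((p v).darts.map fun d => x d.fst d.snd).sum
  have hconcat {u v : S} (h : T.Adj u v) (hu : u ∈ (p v).support) : x u v = f v - f u := by
    have := hT.isAcyclic.path_concat (hp u) (hp v) h hu
    simp only [f]
    rw [this]
    simp
  have htree {u v : S} (h : T.Adj u v) : x u v = f v - f u := by
    by_cases hu : u ∈ (p v).support
    · exact hconcat h hu
    · have hv : v ∈ (p u).support :=
        hT.isAcyclic.mem_support_of_ne_mem_support_of_adj_of_isPath (hp u) (hp v) h hu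
      have := hconcat h.symm hv
      rw [hx] at this
      linarith
  refine ⟨f, fun s t hst => ?_⟩
  by_cases hT' : T.Adj s t
  · exact htree hT'
  obtain ⟨q, hq, -⟩ := hT.existsUnique_path t s
  have hlen : 3 ≤ q.length + 1 := by
    have h0 : q.length ≠ 0 := fun h => hst.ne (SimpleGraph.Walk.eq_of_length_eq_zero h).symm
    have h1 : q.length ≠ 1 := fun h =>
      hT' (SimpleGraph.Walk.adj_of_length_eq_one h).symm
    omega
  let c : Fin (q.length + 1) → S := fun i => q.getVert i
  have hrot (i : Fin q.length) : c (finRotate _ i.castSucc) = q.getVert (i + 1) := by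
    simp only [c]
    rw [coe_finRotate_of_ne_last (Fin.castSucc_lt_last i).ne, Fin.val_castSucc]
  have hlast : c (finRotate _ (Fin.last _)) = t := by
    rw [finRotate_last]; simp [c]
  have hclast : c (Fin.last _) = s := by simp [c]
  have hadj (i : Fin q.length) : T.Adj (c i.castSucc) (c (finRotate _ i.castSucc)) := by
    rw [hrot]
    exact q.adj_getVert_succ i.isLt
  have h := hcyc _ hlen c ?_ ?_
  · rw [Fin.sum_univ_castSucc, hlast, hclast] at h
    have h1 : ∑ i : Fin q.length, x (c i.castSucc) (c (finRotate _ i.castSucc)) = f s - f t := by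
      calc ∑ i : Fin q.length, x (c i.castSucc) (c (finRotate _ i.castSucc))
          = ∑ i : Fin q.length, (f (q.getVert (i + 1)) - f (q.getVert i)) :=
            Finset.sum_congr rfl fun i _ => by rw [htree (hadj i), hrot]; rfl
        _ = ∑ i ∈ Finset.range q.length, (f (q.getVert (i + 1)) - f (q.getVert i)) :=
            Fin.sum_univ_eq_sum_range (fun i => f (q.getVert (i + 1)) - f (q.getVert i)) _
        _ = f s - f t := by
            rw [Finset.sum_range_sub fun i => f (q.getVert i)]; simp
    linarith
  · intro i j hij
    ext
    exact hq.getVert_injOn (by simp; omega) (by simp; omega) hij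
  · intro i
    refine Fin.lastCases ?_ (fun i => hTG (hadj i)) i
    rw [hlast, hclast]
    exact hst

end Exactness

section Cochains

variable {S : Type*}

/-- The space of antisymmetric functions on the oriented edges of a graph. -/
def cochains (G : SimpleGraph S) : Submodule ℝ (S → S → ℝ) where
  carrier := {x | (∀ s t, x t s = -x s t) ∧ ∀ s t, ¬ G.Adj s t → x s t = 0}
  add_mem' hx hy := ⟨fun s t => by simp [hx.1 s t, hy.1 s t]; ring,
    fun s t h => by simp [hx.2 s t h, hy.2 s t h]⟩
  zero_mem' := ⟨by simp, by simp⟩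
  smul_mem' a x hx := ⟨fun s t => by simp [hx.1 s t], fun s t h => by simp [hx.2 s t h]⟩

/-- Choosing an orientation of each edge identifies the cochains with the functions on the edges. -/
theorem finrank_cochains [Finite S] (G : SimpleGraph S) :
    Module.finrank ℝ (cochains G) = G.edgeSet.ncard := by
  classical
  have := Fintype.ofFinite S
  let E : cochains G →ₗ[ℝ] (G.edgeSet → ℝ) :=
    { toFun := fun x e => x.1 (Quot.out e.1).1 (Quot.out e.1).2
      map_add' := fun _ _ => rfl
      map_smul' := fun _ _ => rfl }
  have hout (e : Sym2 S) : s((Quot.out e).1, (Quot.out e).2) = e := Quot.out_eq e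
  have hbij : Function.Bijective E := by
    constructor
    · rw [injective_iff_map_eq_zero]
      intro x hx
      ext s t
      by_cases h : G.Adj s t
      · have h1 := congrFun hx ⟨s(s, t), h⟩
        change x.1 (Quot.out s(s, t)).1 (Quot.out s(s, t)).2 = 0 at h1
        rcases Sym2.eq_iff.1 (hout s(s, t)) with ⟨e1, e2⟩ | ⟨e1, e2⟩
        · rwa [e1, e2] at h1
        · rw [e1, e2, x.2.1 s t] at h1
          simpa using h1
      · exact x.2.2 s t h
    · intro y
      let z : Sym2 S → ℝ := fun e => if h : e ∈ G.edgeSet then y ⟨e, h⟩ else 0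
      have hz {s t : S} (h : ¬ G.Adj s t) : z s(s, t) = 0 :=
        dif_neg (by rwa [SimpleGraph.mem_edgeSet])
      refine ⟨⟨fun s t => if Quot.out s(s, t) = (s, t) then z s(s, t) else -z s(s, t),
        fun s t => ?_, fun s t h => ?_⟩, ?_⟩
      · have e' : (s(t, s) : Sym2 S) = s(s, t) := Sym2.eq_swap
        simp only [e']
        by_cases h : G.Adj s t
        · have hne := h.ne
          rcases Sym2.eq_iff.1 (hout s(s, t)) with ⟨e1, e2⟩ | ⟨e1, e2⟩
          · rw [if_neg fun h => hne (by rw [← e1, h]), if_pos (Prod.ext e1 e2)]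
          · rw [if_pos (Prod.ext e1 e2), if_neg fun h => hne (by rw [← e2, h]), neg_neg]
        · simp [hz h]
      · simp [hz h]
      · funext e
        change (if Quot.out s((Quot.out e.1).1, (Quot.out e.1).2) = _ then _ else _) = _
        rw [hout, if_pos rfl]
        exact dif_pos e.2
  rw [(LinearEquiv.ofBijective E hbij).finrank_eq, Module.finrank_fintype_fun_eq_card,
    ← Nat.card_eq_fintype_card]
  rfl

/-- The coboundary of a function on the vertices. -/
noncomputable def coboundary (G : SimpleGraph S) : (S → ℝ) →ₗ[ℝ] cochains G := by
  classical
  exact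
  { toFun := fun f => ⟨fun s t => if G.Adj s t then f t - f s else 0, fun s t => by
        simp only [G.adj_comm t s]
        by_cases h : G.Adj s t <;> simp [h], fun s t h => if_neg h⟩
    map_add' := fun f g => by
      ext s t
      by_cases h : G.Adj s t
      · simp [h]; ring
      · simp [h]
    map_smul' := fun a f => by
      ext s t
      by_cases h : G.Adj s t
      · simp [h]; ring
      · simp [h] }

theorem coboundary_apply {G : SimpleGraph S} (f : S → ℝ) {s t : S} (h : G.Adj s t) :
    (coboundary G f).1 s t = f t - f s := by
  simp [coboundary, h]

theorem finrank_ker_coboundary [Finite S] {G : SimpleGraph S} (hG : G.Connected) :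
    Module.finrank ℝ (LinearMap.ker (coboundary G)) = 1 := by
  have := hG.nonempty
  have hker : LinearMap.ker (coboundary G) = Submodule.span ℝ {fun _ => (1 : ℝ)} := by
    ext f
    rw [LinearMap.mem_ker, Submodule.mem_span_singleton]
    constructor
    · intro hf
      refine ⟨f (Classical.arbitrary S), ?_⟩
      have hadj (s t : S) (h : G.Adj s t) : f s = f t := by
        have h1 := coboundary_apply f h
        rw [hf] at h1
        have h2 : (0 : ℝ) = f t - f s := h1
        linarith
      have hwalk (s t : S) (w : G.Walk s t) : f s = f t := by
        induction w with
        | nil => rfl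
        | cons h _ ih => exact (hadj _ _ h).trans ih
      funext s
      obtain ⟨w⟩ := hG.preconnected (Classical.arbitrary S) s
      simpa using hwalk _ _ w
    · rintro ⟨a, rfl⟩
      ext s t
      by_cases h : G.Adj s t
      · rw [coboundary_apply _ h]; simp
      · exact (coboundary G _).2.2 s t h
  rw [hker]
  exact finrank_span_singleton (Function.ne_iff.2 ⟨Classical.arbitrary S, one_ne_zero⟩)

variable (M : CoxeterMatrix S)

/-- Integration of cochains over the relevant circuits. -/
def circuitIntegral : cochains (diagram M) →ₗ[ℝ] (RelevantCircuit M → ℝ) where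
  toFun x C := ∑ i, x.1 (C.c i) (C.c (finRotate C.k i))
  map_add' x y := by
    funext C
    exact Finset.sum_add_distrib
  map_smul' a x := by
    funext C
    exact (Finset.mul_sum _ _ _).symm

variable {M}

theorem RelevantCircuit.adj (C : RelevantCircuit M) (i : Fin C.k) :
    (diagram M).Adj (C.c i) (C.c (finRotate C.k i)) := by
  rcases C.relevant with h | h
  · exact h.2 i
  · have h0 := h.2 i
    refine ⟨fun e => ?_, by omega⟩
    have h1 := M.diagonal (C.c i)
    change M (C.c i) (C.c i) = 1 at h1
    rw [← e] at h0
    omega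

theorem ker_circuitIntegral (hM : IsIrreducible M) :
    LinearMap.ker (circuitIntegral M) = LinearMap.range (coboundary (diagram M)) := by
  have := SimpleGraph.Connected.nonempty hM
  ext x
  rw [LinearMap.mem_ker, LinearMap.mem_range]
  constructor
  · intro hx
    obtain ⟨f, hf⟩ := exists_potential hM x.2.1 fun k hk c hc hadj =>
      congrFun hx ⟨k, c, hc, Or.inl ⟨hk, hadj⟩⟩
    refine ⟨f, ?_⟩
    ext s t
    by_cases h : (diagram M).Adj s t
    · rw [coboundary_apply _ h, hf s t h]
    · exact (coboundary _ _).2.2 s t h |>.trans (x.2.2 s t h).symm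
  · rintro ⟨f, rfl⟩
    funext C
    change ∑ i, (coboundary (diagram M) f).1 (C.c i) (C.c (finRotate C.k i)) = 0
    simp_rw [coboundary_apply f (C.adj _)]
    rw [Finset.sum_sub_distrib, Equiv.sum_comp (finRotate C.k) fun i => f (C.c i), sub_self]

theorem finrank_range_circuitIntegral [Fintype S] (hM : IsIrreducible M) :
    Module.finrank ℝ (LinearMap.range (circuitIntegral M)) + Fintype.card S = edgeCount M + 1 := by
  have h1 := (circuitIntegral M).finrank_range_add_finrank_ker
  have h2 := (coboundary (diagram M)).finrank_range_add_finrank_ker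
  rw [finrank_ker_coboundary hM, Module.finrank_fintype_fun_eq_card] at h2
  rw [ker_circuitIntegral hM, finrank_cochains] at h1
  unfold edgeCount
  omega

end Cochains

/-! ### Cartan matrices realizing a Coxeter matrix -/

section Compatible

variable {S : Type*}

/-- A Cartan matrix with the dihedral angles `π / M s t`. At a label `∞`, written `0`, the
product is required to be `4`, so the notion is meant for Coxeter matrices without such labels. -/
structure IsCartanOf (M : CoxeterMatrix S) (A : S → S → ℝ) : Prop extends IsCartanMatrix A where
  angle : ∀ s t, s ≠ t → A s t * A t s = 4 * Real.cos (Real.pi / M s t) ^ 2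

variable {M : CoxeterMatrix S} {A A' : S → S → ℝ}

theorem CoxeterPolytope.Realizes.isCartanOf {V : Type*} [AddCommGroup V] [Module ℝ V]
    [TopologicalSpace V] {P : CoxeterPolytope S V} (hP : P.Realizes M) (h0 : ∀ s t, M s t ≠ 0) :
    IsCartanOf M P.cartanMatrix where
  toIsCartanMatrix := P.isCartan
  angle s t h := by
    have := hP.2 s t h
    rwa [CoxeterPolytope.HasDihedralAngle, if_neg (h0 s t)] at this

theorem isCartanOf_cosineMatrix (M : CoxeterMatrix S) : IsCartanOf M (cosineMatrix M) where
  toIsCartanMatrix := isCartanMatrix_cosineMatrix M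
  angle s t _ := by
    simp only [cosineMatrix, M.symmetric t s]; ring

theorem IsCartanOf.mul_eq (hA : IsCartanOf M A) {s t : S} (h : s ≠ t) :
    A s t * A t s = cosineMatrix M s t * cosineMatrix M t s := by
  rw [hA.angle s t h, (isCartanOf_cosineMatrix M).angle s t h]

theorem IsCartanOf.neg_of_adj (hA : IsCartanOf M A) {s t : S} (h : (diagram M).Adj s t) :
    A s t < 0 := by
  have h1 := cosineMatrix_le_neg_one M h
  have h2 := cosineMatrix_le_neg_one M h.symm
  have h3 : 0 < A s t * A t s := by
    rw [hA.mul_eq h.1]; nlinarith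
  rcases hA.sign s t h.1 with h4 | h4
  · rw [h4.1, zero_mul] at h3
    exact absurd h3 (lt_irrefl _)
  · exact h4.1

theorem IsCartanOf.eq_zero (hA : IsCartanOf M A) {s t : S} (hst : s ≠ t)
    (h : ¬ (diagram M).Adj s t) : A s t = 0 := by
  have h3 : A s t * A t s = 0 := by
    rw [hA.mul_eq hst, cosineMatrix_eq_zero M hst h, zero_mul]
  rcases hA.sign s t hst with h4 | h4
  · exact h4.1
  · exact absurd h3 (mul_pos_of_neg_of_neg h4.1 h4.2).ne'

/-- The cochain `log (A s t / A t s)`. -/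
noncomputable def IsCartanOf.logCochain (hA : IsCartanOf M A) : cochains (diagram M) :=
  ⟨fun s t => Real.log (A s t / A t s),
    fun s t => by rw [← Real.log_inv, inv_div],
    fun s t h => by
      rcases eq_or_ne s t with rfl | hst
      · simp [hA.diag]
      · simp [hA.eq_zero hst h]⟩

theorem IsCartanOf.div_eq_exp (hA : IsCartanOf M A) {s t : S} (h : (diagram M).Adj s t) :
    A s t / A t s = Real.exp (hA.logCochain.1 s t) :=
  (Real.exp_log (div_pos_of_neg_of_neg (hA.neg_of_adj h) (hA.neg_of_adj h.symm))).symm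

theorem IsCartanOf.normalizedCyclicProduct_eq (hA : IsCartanOf M A) (C : RelevantCircuit M) :
    normalizedCyclicProduct A C = circuitIntegral M hA.logCochain C := by
  rw [normalizedCyclicProduct, cyclicProduct_rev, cyclicProduct, ← Finset.prod_div_distrib,
    Real.log_prod]
  · rfl
  · intro i _
    exact div_ne_zero (hA.neg_of_adj (C.adj i)).ne (hA.neg_of_adj (C.adj i).symm).ne

/-- Two Cartan matrices with the same angles whose cochains differ by a coboundary are conjugate by
a positive diagonal matrix. -/
theorem IsCartanOf.exists_scaling (hA : IsCartanOf M A) (hA' : IsCartanOf M A')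
    {f : S → ℝ} (hf : coboundary (diagram M) f = hA'.logCochain - hA.logCochain) (s t : S) :
    A' s t * Real.exp (-f t / 2) = Real.exp (-f s / 2) * A s t := by
  rcases eq_or_ne s t with rfl | hst
  · rw [hA.diag, hA'.diag, mul_comm]
  by_cases h : (diagram M).Adj s t
  · have n1 := hA.neg_of_adj h
    have n2 := hA'.neg_of_adj h
    have n3 := hA.neg_of_adj h.symm
    have n4 := hA'.neg_of_adj h.symm
    have h1 := coboundary_apply f h
    rw [hf] at h1
    have h2 : hA'.logCochain.1 s t = hA.logCochain.1 s t + (f t - f s) := by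
      have : (hA'.logCochain - hA.logCochain).1 s t =
        hA'.logCochain.1 s t - hA.logCochain.1 s t := rfl
      linarith
    have h3 := hA'.div_eq_exp h
    rw [h2, Real.exp_add, ← hA.div_eq_exp h] at h3
    have h4 : A' s t * A' t s = A s t * A t s := by rw [hA.mul_eq hst, hA'.mul_eq hst]
    have h5 : A' s t ^ 2 = Real.exp (f t - f s) * A s t ^ 2 := by
      have e1 := n3.ne
      have e2 := n4.ne
      field_simp at h3
      have : A' s t * (A' s t * A' t s) = A' s t * (A s t * A t s) := by rw [h4]
      have h6 : A t s * A' s t ^ 2 = A t s * (Real.exp (f t - f s) * A s t ^ 2) := by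
        have e3 : A s t * A' t s * Real.exp (f t - f s) = A' s t * A t s := by linarith
        have e4 := n2.ne
        have : A' s t * (A t s * A' s t ^ 2) =
            A' s t * (A t s * (Real.exp (f t - f s) * A s t ^ 2)) := by
          linear_combination A' s t ^ 2 * (-e3) + A' s t * A s t * Real.exp (f t - f s) * h4
        exact mul_left_cancel₀ e4 this
      exact mul_left_cancel₀ e1 h6
    -- both sides are negative, so it suffices to compare their squares
    have h6 : (A' s t * Real.exp (-f t / 2)) ^ 2 = (Real.exp (-f s / 2) * A s t) ^ 2 := by
      rw [mul_pow, mul_pow, h5, ← Real.exp_nat_mul, ← Real.exp_nat_mul, mul_right_comm,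
        ← Real.exp_add]
      congr 2
      push_cast; ring
    rcases sq_eq_sq_iff_eq_or_eq_neg.1 h6 with h7 | h7
    · exact h7
    · have p1 := mul_neg_of_neg_of_pos n2 (Real.exp_pos (-f t / 2))
      have p2 := mul_neg_of_pos_of_neg (Real.exp_pos (-f s / 2)) n1
      linarith
  · rw [hA.eq_zero hst h, hA'.eq_zero hst h]; simp

/-- The Cartan matrix with given angles and given cochain `x`. -/
noncomputable def expMatrix (M : CoxeterMatrix S) (x : cochains (diagram M)) : S → S → ℝ :=
  fun s t => cosineMatrix M s t * Real.exp (x.1 s t / 2)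

theorem expMatrix_mul (x : cochains (diagram M)) (s t : S) :
    expMatrix M x s t * expMatrix M x t s = cosineMatrix M s t * cosineMatrix M t s := by
  have : Real.exp (x.1 s t / 2) * Real.exp (x.1 t s / 2) = 1 := by
    rw [← Real.exp_add, x.2.1 s t, ← add_div]; simp
  unfold expMatrix
  linear_combination cosineMatrix M s t * cosineMatrix M t s * this

theorem isCartanOf_expMatrix (x : cochains (diagram M)) : IsCartanOf M (expMatrix M x) where
  diag s := by
    rw [expMatrix, cosineMatrix_self, x.2.2 s s ((diagram M).irrefl)]; simp
  sign s t h := by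
    rcases (isCartanMatrix_cosineMatrix M).sign s t h with h | h
    · left; simp [expMatrix, h.1, h.2]
    · right
      exact ⟨mul_neg_of_neg_of_pos h.1 (Real.exp_pos _), mul_neg_of_neg_of_pos h.2 (Real.exp_pos _)⟩
  prod s t h := by
    rw [expMatrix_mul]
    exact (isCartanMatrix_cosineMatrix M).prod s t h
  angle s t h := by
    rw [expMatrix_mul]
    exact (isCartanOf_cosineMatrix M).angle s t h

theorem logCochain_expMatrix (x : cochains (diagram M)) :
    (isCartanOf_expMatrix x).logCochain = x := by
  ext s t
  by_cases h : (diagram M).Adj s t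
  · have h1 : cosineMatrix M s t ≠ 0 := ((isCartanOf_cosineMatrix M).neg_of_adj h).ne
    change Real.log (cosineMatrix M s t * Real.exp (x.1 s t / 2) /
      (cosineMatrix M t s * Real.exp (x.1 t s / 2))) = _
    rw [cosineMatrix_symm M t s, mul_div_mul_left _ _ h1, ← Real.exp_sub, Real.log_exp,
      x.2.1 s t]
    ring
  · rw [(isCartanOf_expMatrix x).logCochain.2.2 s t h, x.2.2 s t h]

theorem cyclicProduct_eq_of_scaling {μ : S → ℝ} (hμ : ∀ s, μ s ≠ 0)
    (h : ∀ s t, A' s t * μ t = μ s * A s t) {k : ℕ} (c : Fin k → S) :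
    cyclicProduct A' c = cyclicProduct A c := by
  have h1 : (∏ i, A' (c i) (c (finRotate k i))) * ∏ i, μ (c (finRotate k i)) =
      (∏ i, μ (c i)) * ∏ i, A (c i) (c (finRotate k i)) := by
    rw [← Finset.prod_mul_distrib, ← Finset.prod_mul_distrib]
    exact Finset.prod_congr rfl fun i _ => h _ _
  rw [Equiv.prod_comp (finRotate k) fun i => μ (c i), mul_comm] at h1
  exact mul_left_cancel₀ (Finset.prod_ne_zero_iff.2 fun i _ => hμ _) h1

end Compatible

/-! ### Coxeter simplices and their isomorphisms -/

section Simplices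

variable {S : Type*} [Fintype S]

/-- A Coxeter polytope with `#S` facets in `𝕊(ℝ^S)` is a simplex: as it is properly convex, the
forms `α s` have no common zero, so they are coordinates. -/
noncomputable def CoxeterPolytope.coordinates (P : CoxeterPolytope S (S → ℝ)) :
    (S → ℝ) ≃ₗ[ℝ] (S → ℝ) :=
  LinearEquiv.ofInjectiveEndo (LinearMap.pi P.α) <| by
    rw [injective_iff_map_eq_zero]
    intro x hx
    obtain ⟨f, hf⟩ := P.properly_convex
    by_contra h0
    have hα (s : S) : P.α s x = 0 := congrFun hx s
    have h1 := hf x (fun s => (hα s).le) h0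
    have h2 := hf (-x) (fun s => by rw [map_neg, hα, neg_zero]) (neg_ne_zero.2 h0)
    rw [map_neg] at h2
    linarith

theorem CoxeterPolytope.coordinates_apply (P : CoxeterPolytope S (S → ℝ)) (x : S → ℝ) (s : S) :
    P.coordinates x s = P.α s x := rfl

theorem CoxeterPolytope.refl_apply {S V : Type*} [AddCommGroup V] [Module ℝ V] [TopologicalSpace V]
    (P : CoxeterPolytope S V) (s : S) (x : V) : P.refl s x = x - P.α s x • P.b s := by
  simp [CoxeterPolytope.refl, Module.reflection_apply]

/-- Realizations in `𝕊(ℝ^S)` are determined up to isomorphism by the Cartan matrix modulo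
conjugation by positive diagonal matrices. -/
theorem CoxeterPolytope.isomorphic_of_scaling {P P' : CoxeterPolytope S (S → ℝ)} {μ : S → ℝ}
    (hμ : ∀ s, 0 < μ s) (h : ∀ s t, P'.cartanMatrix s t * μ t = μ s * P.cartanMatrix s t) :
    P.Isomorphic P' := by
  let D : (S → ℝ) ≃ₗ[ℝ] (S → ℝ) :=
    LinearEquiv.piCongrRight fun s => LinearEquiv.smulOfNeZero ℝ ℝ (μ s) (hμ s).ne'
  let ψ := (P.coordinates.trans D).trans P'.coordinates.symm
  have hψ (s : S) (x : S → ℝ) : P'.α s (ψ x) = μ s * P.α s x := by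
    rw [← P'.coordinates_apply]
    simp [ψ, D, P.coordinates_apply]
  have hb (t : S) : ψ (P.b t) = μ t • P'.b t := by
    apply P'.coordinates.injective
    funext s
    rw [P'.coordinates_apply, P'.coordinates_apply, hψ, map_smul, smul_eq_mul, mul_comm (μ t)]
    exact (h s t).symm
  have himg {K K' : Set (S → ℝ)} (hK : ∀ x, ψ x ∈ K' ↔ x ∈ K) : ψ '' K = K' := by
    ext y
    constructor
    · rintro ⟨x, hx, rfl⟩
      exact (hK x).2 hx
    · intro hy
      obtain ⟨x, rfl⟩ := ψ.surjective y
      exact ⟨x, (hK x).1 hy, rfl⟩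
  have hcar (x : S → ℝ) : ψ x ∈ P'.carrier ↔ x ∈ P.carrier := by
    refine forall_congr' fun s => ?_
    rw [hψ]
    exact mul_nonpos_iff_pos_imp_nonpos.trans (by
      constructor
      · intro h'; exact h'.1 (hμ s)
      · intro h'; exact ⟨fun _ => h', fun _ => (hμ s).le⟩)
  refine ⟨ψ, himg hcar, fun s => himg fun x => and_congr (hcar x) ?_, fun s x => ?_⟩
  · rw [hψ, mul_eq_zero]
    exact or_iff_right (hμ s).ne'
  · rw [P.refl_apply, P'.refl_apply, map_sub, map_smul, hb, hψ, smul_smul, mul_comm]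

theorem CoxeterPolytope.Isomorphic.exists_scaling {S V : Type*} [AddCommGroup V] [Module ℝ V]
    [TopologicalSpace V] {P P' : CoxeterPolytope S V} (h : P.Isomorphic P') :
    ∃ μ : S → ℝ, (∀ s, μ s ≠ 0) ∧
      ∀ s t, P'.cartanMatrix s t * μ t = μ s * P.cartanMatrix s t := by
  obtain ⟨ψ, -, -, h⟩ := h
  have h1 (s : S) (x : V) : P.α s x • ψ (P.b s) = P'.α s (ψ x) • P'.b s := by
    have := h s x
    rw [P.refl_apply, P'.refl_apply, map_sub, map_smul] at this
    exact sub_right_injective this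
  have hd (s : S) : P.α s (P.b s) = 2 := P.isCartan.diag s
  have hd' (s : S) : P'.α s (P'.b s) = 2 := P'.isCartan.diag s
  have h2 (s : S) : ψ (P.b s) = (P'.α s (ψ (P.b s)) / 2) • P'.b s := by
    have := h1 s (P.b s)
    rw [hd] at this
    rw [div_eq_inv_mul, mul_smul, ← this, smul_smul]; norm_num
  refine ⟨fun s => P'.α s (ψ (P.b s)) / 2, fun s h0 => ?_, fun s t => ?_⟩
  · have h3 := h2 s
    rw [show P'.α s (ψ (P.b s)) / 2 = 0 from h0, zero_smul] at h3
    have h4 : P.b s = 0 := by simpa using h3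
    have h5 := hd s
    rw [h4, map_zero] at h5
    norm_num at h5
  · have h3 := congrArg (P'.α s) (h1 s (P.b t))
    rw [map_smul, map_smul, hd'] at h3
    simp only [smul_eq_mul] at h3
    have h4 := congrArg (P'.α s) (h2 t)
    rw [map_smul, smul_eq_mul] at h4
    simp only [CoxeterPolytope.cartanMatrix]
    linarith

theorem CoxeterPolytope.Isomorphic.normalizedCyclicProduct_eq {S V : Type*} {M : CoxeterMatrix S}
    [AddCommGroup V] [Module ℝ V] [TopologicalSpace V] {P P' : CoxeterPolytope S V}
    (h : P.Isomorphic P') (C : RelevantCircuit M) :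
    normalizedCyclicProduct P.cartanMatrix C = normalizedCyclicProduct P'.cartanMatrix C := by
  obtain ⟨μ, hμ, h⟩ := h.exists_scaling
  rw [normalizedCyclicProduct, normalizedCyclicProduct, cyclicProduct_eq_of_scaling hμ h,
    cyclicProduct_eq_of_scaling hμ h]

/-- The face of the cone `{x ≤ 0}` on which the coordinates in `T` vanish. -/
def coordinateFace (T : Set S) : Set (S → ℝ) := {x | (∀ s, x s ≤ 0) ∧ ∀ s ∈ T, x s = 0}

theorem isFace_coordinateFace (T : Set S) :
    IsFace {x : S → ℝ | ∀ s, x s ≤ 0} (coordinateFace T) := by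
  classical
  have hl (x : S → ℝ) : (∑ s, if s ∈ T then LinearMap.proj s else 0 : Module.Dual ℝ (S → ℝ)) x =
      ∑ s, if s ∈ T then x s else 0 := by
    rw [LinearMap.sum_apply]
    exact Finset.sum_congr rfl fun s _ => by split_ifs <;> simp
  have hnonpos (x : S → ℝ) (hx : ∀ s, x s ≤ 0) (s : S) : (if s ∈ T then x s else 0) ≤ 0 := by
    split_ifs
    exacts [hx s, le_rfl]
  refine ⟨∑ s, if s ∈ T then LinearMap.proj s else 0, fun x hx => ?_, ?_⟩
  · rw [hl]
    exact Finset.sum_nonpos fun s _ => hnonpos x hx s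
  · ext x
    refine and_congr_right fun hx => ?_
    rw [hl, Finset.sum_eq_zero_iff_of_nonpos fun s _ => hnonpos x hx s]
    simp

theorem exists_eq_coordinateFace {F : Set (S → ℝ)} (hF : IsFace {x : S → ℝ | ∀ s, x s ≤ 0} F) :
    ∃ T : Set S, coordinateFace T = F := by
  classical
  obtain ⟨l, hl, rfl⟩ := hF
  have hsum (x : S → ℝ) : l x = ∑ s, x s * l (Pi.single s 1) := by
    conv_lhs => rw [pi_eq_sum_univ' x]
    simp
  have hpos (s : S) : 0 ≤ l (Pi.single s 1) := by
    have := hl (-Pi.single s 1) fun t => by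
      by_cases h : t = s <;> simp [h]
    rw [map_neg] at this
    linarith
  refine ⟨{s | l (Pi.single s 1) ≠ 0}, ?_⟩
  ext x
  refine and_congr_right fun hx => ?_
  rw [hsum, Finset.sum_eq_zero_iff_of_nonpos fun s _ =>
    mul_nonpos_of_nonpos_of_nonneg (hx s) (hpos s)]
  simp only [Set.mem_ofPred_eq, Finset.mem_univ, true_implies, mul_eq_zero]
  exact forall_congr' fun s => by tauto

theorem coordinateFace_subset_iff {S : Type*} {T T' : Set S} :
    coordinateFace T ⊆ coordinateFace T' ↔ T' ⊆ T := by
  classical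
  constructor
  · intro h s hs
    by_contra hsT
    have h1 : (fun s => if s ∈ T then (0 : ℝ) else -1) ∈ coordinateFace T :=
      ⟨fun s => by dsimp only; split_ifs <;> norm_num, fun s hs => if_pos hs⟩
    have h2 := (h h1).2 s hs
    simp [hsT] at h2
  · exact fun h x hx => ⟨hx.1, fun s hs => hx.2 s (h hs)⟩

/-- The faces of the cone `{x ≤ 0}` are its intersections with coordinate subspaces, so their poset
is that of a simplex. -/
theorem realizes_coxeterSimplex {M : CoxeterMatrix S} {A : S → S → ℝ} (hA : IsCartanOf M A)
    (h0 : ∀ s t, M s t ≠ 0) : (coxeterSimplex A hA.toIsCartanMatrix).Realizes M := by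
  refine ⟨⟨RelIso.ofSurjective (OrderEmbedding.ofMapLEIff
    (fun T : (Set S)ᵒᵈ => (⟨coordinateFace (OrderDual.ofDual T), isFace_coordinateFace _⟩ :
      {F : Set (S → ℝ) // IsFace (coxeterSimplex A hA.toIsCartanMatrix).carrier F}))
    fun T T' => coordinateFace_subset_iff) ?_, fun s => ?_⟩, fun s t hst => ?_⟩
  · rintro ⟨F, hF⟩
    obtain ⟨T, rfl⟩ := exists_eq_coordinateFace hF
    exact ⟨OrderDual.toDual T, rfl⟩
  · change coordinateFace {s} = _
    ext x
    refine and_congr_right fun _ => ?_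
    simp [coxeterSimplex]
  · rw [CoxeterPolytope.HasDihedralAngle, if_neg (h0 s t)]
    exact hA.angle s t hst

end Simplices

/-! ### Parametrization of the deformation space -/

section Parametrization

variable {S : Type*} {M : CoxeterMatrix S}

/-- The normalized cyclic products of the relevant circuits, as a map on the deformation space. -/
noncomputable def cyclicProductMap (M : CoxeterMatrix S) :
    DeformationSpace M → RelevantCircuit M → ℝ :=
  Quotient.lift (fun P C => normalizedCyclicProduct P.1.cartanMatrix C)
    fun _ _ h => funext fun C => CoxeterPolytope.Isomorphic.normalizedCyclicProduct_eq h C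

theorem cyclicProductMap_mk {P : CoxeterPolytope S (S → ℝ)} (hP : P.Realizes M) :
    cyclicProductMap M (DeformationSpace.mk P hP) = normalizedCyclicProduct P.cartanMatrix := rfl

theorem cyclicProductMap_mem_range (h0 : ∀ s t, M s t ≠ 0) (p : DeformationSpace M) :
    cyclicProductMap M p ∈ LinearMap.range (circuitIntegral M) := by
  obtain ⟨P⟩ := p
  exact ⟨(P.2.isCartanOf h0).logCochain,
    funext fun C => ((P.2.isCartanOf h0).normalizedCyclicProduct_eq C).symm⟩

variable [Fintype S]

theorem continuous_cartanMatrix (s t : S) :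
    Continuous fun P : CoxeterPolytope S (S → ℝ) => P.cartanMatrix s t := by
  classical
  have h : Continuous (fun P : CoxeterPolytope S (S → ℝ) =>
    ((fun s x => P.α s x, P.b) : (S → (S → ℝ) → ℝ) × (S → S → ℝ))) := continuous_induced_dom
  have h1 (x : S → ℝ) : Continuous fun P : CoxeterPolytope S (S → ℝ) => P.α s x :=
    (continuous_apply x).comp ((continuous_apply s).comp (continuous_fst.comp h))
  have h2 (i : S) : Continuous fun P : CoxeterPolytope S (S → ℝ) => P.b t i :=
    (continuous_apply i).comp ((continuous_apply t).comp (continuous_snd.comp h))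
  have h3 : (fun P : CoxeterPolytope S (S → ℝ) => P.cartanMatrix s t) =
      fun P => ∑ i, P.b t i * P.α s (Pi.single i 1) := by
    funext P
    rw [CoxeterPolytope.cartanMatrix]
    conv_lhs => rw [pi_eq_sum_univ' (P.b t)]
    simp
  rw [h3]
  exact continuous_finsetSum _ fun i _ => (h2 i).mul (h1 _)

theorem continuous_cyclicProductMap (h0 : ∀ s t, M s t ≠ 0) :
    Continuous (cyclicProductMap M) := by
  refine Continuous.quotient_lift ?_ _
  refine continuous_pi fun C => ?_
  have h1 (s t : S) : Continuous fun P : Realization M => P.1.cartanMatrix s t :=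
    (continuous_cartanMatrix s t).comp continuous_subtype_val
  have h2 (P : Realization M) := P.2.isCartanOf h0
  refine Continuous.log (Continuous.div ?_ ?_ ?_) ?_
  · exact continuous_finsetProd _ fun i _ => h1 _ _
  · exact continuous_finsetProd _ fun i _ => h1 _ _
  · intro P
    rw [cyclicProduct_rev]
    exact Finset.prod_ne_zero_iff.2 fun i _ => ((h2 P).neg_of_adj (C.adj i).symm).ne
  · intro P
    rw [cyclicProduct_rev]
    exact div_ne_zero
      (Finset.prod_ne_zero_iff.2 fun i _ => ((h2 P).neg_of_adj (C.adj i)).ne)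
      (Finset.prod_ne_zero_iff.2 fun i _ => ((h2 P).neg_of_adj (C.adj i).symm).ne)

theorem cyclicProductMap_injective (hM : IsIrreducible M) (h0 : ∀ s t, M s t ≠ 0) :
    Function.Injective (cyclicProductMap M) := by
  rintro ⟨P⟩ ⟨P'⟩ h
  have hA := P.2.isCartanOf h0
  have hA' := P'.2.isCartanOf h0
  have h1 : circuitIntegral M hA.logCochain = circuitIntegral M hA'.logCochain := by
    funext C
    rw [← hA.normalizedCyclicProduct_eq, ← hA'.normalizedCyclicProduct_eq]
    exact congrFun h C
  have h2 : hA'.logCochain - hA.logCochain ∈ LinearMap.ker (circuitIntegral M) := by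
    rw [LinearMap.mem_ker, map_sub, h1, sub_self]
  rw [ker_circuitIntegral hM] at h2
  obtain ⟨f, hf⟩ := h2
  exact Quotient.sound (CoxeterPolytope.isomorphic_of_scaling (fun s => Real.exp_pos _)
    (hA.exists_scaling hA' hf))

/-- The Coxeter simplex with given angles and given cochain. -/
noncomputable def simplexOfCochain (h0 : ∀ s t, M s t ≠ 0) (x : cochains (diagram M)) :
    DeformationSpace M :=
  DeformationSpace.mk _ (realizes_coxeterSimplex (isCartanOf_expMatrix x) h0)

theorem continuous_simplexOfCochain (h0 : ∀ s t, M s t ≠ 0) :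
    Continuous (simplexOfCochain h0) := by
  have hx (s t : S) : Continuous fun x : cochains (diagram M) => x.1 s t :=
    (continuous_apply t).comp ((continuous_apply s).comp continuous_subtype_val)
  refine continuous_quotient_mk'.comp (Continuous.subtype_mk (continuous_induced_rng.2 ?_) _)
  refine Continuous.prodMk (f := fun _ => fun s (y : S → ℝ) => y s) continuous_const ?_
  refine continuous_pi fun t => continuous_pi fun s => ?_
  exact continuous_const.mul (Real.continuous_exp.comp ((hx s t).div_const 2))

theorem cyclicProductMap_simplexOfCochain (h0 : ∀ s t, M s t ≠ 0) (x : cochains (diagram M)) :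
    cyclicProductMap M (simplexOfCochain h0 x) = circuitIntegral M x := by
  funext C
  change normalizedCyclicProduct (expMatrix M x) C = _
  rw [(isCartanOf_expMatrix x).normalizedCyclicProduct_eq, logCochain_expMatrix]

/-- The deformation space is homeomorphic to the space of integrals of cochains: the inverse of
`cyclicProductMap` is given by a linear section of `circuitIntegral`. -/
theorem exists_homeomorph (hM : IsIrreducible M) (h0 : ∀ s t, M s t ≠ 0) :
    ∃ e : DeformationSpace M ≃ₜ LinearMap.range (circuitIntegral M),
      ∀ p, (e p : RelevantCircuit M → ℝ) = cyclicProductMap M p := by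
  obtain ⟨g, hg⟩ := (circuitIntegral M).rangeRestrict.exists_rightInverse_of_surjective
    (LinearMap.range_rangeRestrict _)
  have hg' (y : LinearMap.range (circuitIntegral M)) : circuitIntegral M (g y) = y := by
    have := LinearMap.congr_fun hg y
    exact congrArg Subtype.val this
  have hgc : Continuous g := LinearMap.continuous_of_finiteDimensional g
  have hR (y : LinearMap.range (circuitIntegral M)) :
      cyclicProductMap M (simplexOfCochain h0 (g y)) = y := by
    rw [cyclicProductMap_simplexOfCochain, hg']
  exact ⟨{
    toFun := fun p => ⟨cyclicProductMap M p, cyclicProductMap_mem_range h0 p⟩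
    invFun := fun y => simplexOfCochain h0 (g y)
    left_inv := fun p => cyclicProductMap_injective hM h0 (hR _)
    right_inv := fun y => Subtype.ext (hR y)
    continuous_toFun := (continuous_cyclicProductMap h0).subtype_mk _
    continuous_invFun := (continuous_simplexOfCochain h0).comp hgc }, fun _ => rfl⟩

end Parametrization

/-! ### Hyperbolic simplices -/

section Lorentz

variable {d : ℕ}

theorem lorentzForm_comm (x y : Fin (d + 1) → ℝ) : lorentzForm d x y = lorentzForm d y x := by
  simp [lorentzForm, mul_comm]

theorem lorentzForm_sub_smul (x y u : Fin (d + 1) → ℝ) (a : ℝ) :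
    lorentzForm d x (y - a • u) = lorentzForm d x y - a * lorentzForm d x u := by
  simp only [lorentzForm, Pi.sub_apply, Pi.smul_apply, smul_eq_mul, mul_sub, Finset.mul_sum,
    Finset.sum_sub_distrib, mul_left_comm a]
  ring

theorem lorentzForm_neg (x y : Fin (d + 1) → ℝ) : lorentzForm d (-x) y = -lorentzForm d x y := by
  simp [lorentzForm]
  ring

theorem eq_zero_of_lorentzForm_eq_zero {x : Fin (d + 1) → ℝ} (h : ∀ y, lorentzForm d x y = 0) :
    x = 0 := by
  funext k
  have h1 := h (Pi.single k 1)
  refine Fin.lastCases (fun h1 => ?_) (fun k h1 => ?_) k h1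
  · simpa [lorentzForm, Pi.single_apply, (Fin.castSucc_lt_last _).ne] using h1
  · simpa [lorentzForm, Pi.single_apply, (Fin.castSucc_lt_last _).ne'] using h1

/-- Reflections in spacelike vectors do not exchange the two halves of the time cone: `x` and its
image have negative Lorentzian product. -/
theorem last_pos_of_reflection {u x : Fin (d + 1) → ℝ} (hu : lorentzForm d u u = 2)
    (hx : lorentzForm d x x < 0) (hx0 : 0 < x (Fin.last d)) :
    0 < (x - lorentzForm d u x • u) (Fin.last d) := by
  set x' := x - lorentzForm d u x • u with hx'
  have h1 : lorentzForm d x x' ≤ lorentzForm d x x := by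
    rw [hx', lorentzForm_sub_smul, lorentzForm_comm x u]
    nlinarith [mul_self_nonneg (lorentzForm d u x)]
  have h2 : lorentzForm d x' x' = lorentzForm d x x := by
    conv_lhs => rw [hx', lorentzForm_sub_smul, lorentzForm_comm _ x, lorentzForm_comm _ u,
      lorentzForm_sub_smul, lorentzForm_sub_smul, hu, lorentzForm_comm x u]
    ring
  by_contra! h
  have hcs := Finset.sum_mul_sq_le_sq_mul_sq Finset.univ (fun i : Fin d => x i.castSucc)
    (fun i => x' i.castSucc)
  have h3 : lorentzForm d x x' < 0 := lt_of_le_of_lt h1 hx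
  have h4 : lorentzForm d x' x' < 0 := h2.trans_lt hx
  simp only [lorentzForm, ← pow_two] at hx h3 h4
  set a := ∑ i : Fin d, x i.castSucc ^ 2
  set b := ∑ i : Fin d, x' i.castSucc ^ 2
  set c := ∑ i : Fin d, x i.castSucc * x' i.castSucc
  have ha : 0 ≤ a := Finset.sum_nonneg fun i _ => sq_nonneg _
  have hb : 0 ≤ b := Finset.sum_nonneg fun i _ => sq_nonneg _
  have h5 : c < x (Fin.last d) * x' (Fin.last d) := by linarith
  have h6 : x (Fin.last d) * x' (Fin.last d) ≤ 0 := mul_nonpos_of_nonneg_of_nonpos hx0.le h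
  have h7 : (x (Fin.last d) * x' (Fin.last d)) ^ 2 < c ^ 2 := by nlinarith
  have h8 : a * b ≤ x (Fin.last d) ^ 2 * x' (Fin.last d) ^ 2 :=
    mul_le_mul (by linarith) (by linarith) hb (sq_nonneg _)
  rw [mul_pow] at h7
  linarith

theorem IsOPlus.inv {g : (Fin (d + 1) → ℝ) ≃ₗ[ℝ] (Fin (d + 1) → ℝ)} (hg : IsOPlus d g) :
    IsOPlus d g⁻¹ := by
  have hgg (x : Fin (d + 1) → ℝ) : g (g⁻¹ x) = x := g.apply_symm_apply x
  have hform (x y : Fin (d + 1) → ℝ) : lorentzForm d (g⁻¹ x) (g⁻¹ y) = lorentzForm d x y := by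
    rw [← hg.1, hgg, hgg]
  refine ⟨hform, fun x hx hx0 => ?_⟩
  have hx' : lorentzForm d (g⁻¹ x) (g⁻¹ x) < 0 := by rwa [hform]
  have hx'' : lorentzForm d (-g⁻¹ x) (-g⁻¹ x) < 0 := by
    rwa [lorentzForm_neg, lorentzForm_comm, lorentzForm_neg, neg_neg]
  rcases lt_trichotomy (g⁻¹ x (Fin.last d)) 0 with h | h | h
  · have h1 := hg.2 (-g⁻¹ x) hx'' (by simpa using h)
    rw [map_neg, hgg, Pi.neg_apply] at h1
    linarith
  · rw [lorentzForm, h, mul_zero, sub_zero] at hx'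
    exact absurd hx' (not_lt.2 (Finset.sum_nonneg fun i _ => mul_self_nonneg _))
  · exact h

end Lorentz

theorem normalizedCyclicProduct_eq_zero {S : Type*} {M : CoxeterMatrix S} {A : S → S → ℝ}
    {μ : S → ℝ} (hμ : ∀ s, μ s ≠ 0) (h : ∀ s t, A t s * μ t = μ s * A s t)
    (C : RelevantCircuit M) : normalizedCyclicProduct A C = 0 := by
  have h1 := cyclicProduct_eq_of_scaling (A := A) (A' := fun s t => A t s) hμ h C.c
  rw [normalizedCyclicProduct, cyclicProduct_rev, ← h1]
  simp only [cyclicProduct]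
  rcases eq_or_ne (∏ i, A (C.c (finRotate C.k i)) (C.c i)) 0 with h0 | h0
  · rw [h0]; simp
  · rw [div_self h0, Real.log_one]

/-- The Cartan matrix of a hyperbolic Coxeter polytope is symmetrizable, because
`2 Q(b s, ·) = Q(b s, b s) α s` for the invariant Lorentzian form `Q`. -/
theorem CoxeterPolytope.IsHyperbolic.normalizedCyclicProduct_eq_zero {S V : Type*}
    [AddCommGroup V] [Module ℝ V] [TopologicalSpace V] {M : CoxeterMatrix S} {d : ℕ}
    {P : CoxeterPolytope S V} (hP : P.IsHyperbolic d) (C : RelevantCircuit M) :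
    normalizedCyclicProduct P.cartanMatrix C = 0 := by
  obtain ⟨g, hg⟩ := hP
  have hd (s : S) : P.α s (P.b s) = 2 := P.isCartan.diag s
  have hinv (s : S) (x y : V) :
      lorentzForm d (g (P.refl s x)) (g (P.refl s y)) = lorentzForm d (g x) (g y) := by
    have := (hg (P.refl s) (Subgroup.subset_closure ⟨s, rfl⟩)).1 (g x) (g y)
    simpa using this
  have horth (s : S) (y : V) :
      2 * lorentzForm d (g (P.b s)) (g y) =
        P.α s y * lorentzForm d (g (P.b s)) (g (P.b s)) := by
    have h1 := hinv s (P.b s) y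
    have h2 : P.refl s (P.b s) = -P.b s := by
      rw [P.refl_apply, hd, two_smul]; abel
    rw [h2, map_neg, lorentzForm_neg, P.refl_apply, map_sub, map_smul, lorentzForm_sub_smul] at h1
    linarith
  refine ProjCoxeter.normalizedCyclicProduct_eq_zero
    (μ := fun s => lorentzForm d (g (P.b s)) (g (P.b s))) (fun s h0 => ?_) (fun s t => ?_) C
  · have h1 : g (P.b s) = 0 := eq_zero_of_lorentzForm_eq_zero fun y => by
      have h2 := horth s (g.symm y)
      rw [h0, mul_zero, g.apply_symm_apply] at h2
      linarith
    have h2 : P.b s = 0 := by simpa using h1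
    have h3 := hd s
    rw [h2, map_zero] at h3
    norm_num at h3
  · have h1 := horth s (P.b t)
    have h2 := horth t (P.b s)
    rw [lorentzForm_comm] at h2
    simp only [CoxeterPolytope.cartanMatrix]
    linarith

section TitsSimplex

variable {S : Type*} {M : CoxeterMatrix S}

theorem normalizedCyclicProduct_titsSimplex [Finite S] (C : RelevantCircuit M) :
    normalizedCyclicProduct (titsSimplex M).cartanMatrix C = 0 :=
  normalizedCyclicProduct_eq_zero (μ := fun _ => 1) (fun _ => one_ne_zero)
    (fun s t => by rw [one_mul, mul_one]; exact cosineMatrix_symm M t s) C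

/-- Hyperbolicity is invariant under isomorphism. -/
theorem CoxeterPolytope.IsHyperbolic.of_isomorphic {S V : Type*} [AddCommGroup V] [Module ℝ V]
    [TopologicalSpace V] {d : ℕ} {P P' : CoxeterPolytope S V} (hP : P'.IsHyperbolic d)
    (h : P.Isomorphic P') : P.IsHyperbolic d := by
  obtain ⟨g, hg⟩ := hP
  obtain ⟨ψ, -, -, hψ⟩ := h
  refine ⟨ψ.trans g, fun γ hγ => ?_⟩
  let φ : (V ≃ₗ[ℝ] V) →* (V ≃ₗ[ℝ] V) :=
    { toFun := fun γ => (ψ.symm.trans γ).trans ψ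
      map_one' := by ext1 x; simp
      map_mul' := fun γ γ' => by ext1 x; simp }
  have hφ (γ : V ≃ₗ[ℝ] V) : φ γ = (ψ.symm.trans γ).trans ψ := rfl
  have h1 : φ γ ∈ P'.reflectionGroup := by
    have h2 : P.reflectionGroup ≤ P'.reflectionGroup.comap φ := by
      rw [CoxeterPolytope.reflectionGroup, Subgroup.closure_le]
      rintro _ ⟨s, rfl⟩
      have h3 : φ (P.refl s) = P'.refl s := by
        ext1 x
        rw [hφ]
        simp [hψ]
      rw [SetLike.mem_coe, Subgroup.mem_comap, h3]
      exact Subgroup.subset_closure ⟨s, rfl⟩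
    exact h2 hγ
  have h4 : ((ψ.trans g).symm.trans γ).trans (ψ.trans g) = (g.symm.trans (φ γ)).trans g := by
    ext1 x
    simp only [hφ, LinearEquiv.trans_symm, LinearEquiv.trans_apply]
  rw [h4]
  exact hg _ h1

/-- If the form of `M` is the Gram matrix of a Lorentzian basis, the Tits simplex is hyperbolic: the
reflections are the Lorentzian reflections in the basis vectors. -/
theorem isHyperbolic_titsSimplex [Fintype S] {d : ℕ} (hS : Fintype.card S = d + 1)
    {u : S → Fin (d + 1) → ℝ} (hu : ∀ s t, lorentzForm d (u s) (u t) = cosineMatrix M s t)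
    (hu0 : ∀ y, (∀ s, lorentzForm d (u s) y = 0) → y = 0) :
    (titsSimplex M).IsHyperbolic d := by
  let T₀ : (Fin (d + 1) → ℝ) →ₗ[ℝ] (S → ℝ) :=
    { toFun := fun y s => lorentzForm d (u s) y
      map_add' := fun y z => by
        funext s
        have := lorentzForm_sub_smul (u s) y z (-1)
        rw [neg_smul, one_smul, sub_neg_eq_add] at this
        rw [Pi.add_apply, this]; ring
      map_smul' := fun a y => by
        funext s
        have := lorentzForm_sub_smul (u s) 0 y (-a)
        rw [neg_smul, zero_sub, neg_neg] at this
        rw [this]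
        simp [lorentzForm] }
  have hT₀ : Function.Injective T₀ := by
    rw [injective_iff_map_eq_zero]
    exact fun y hy => hu0 y fun s => congrFun hy s
  let T : (Fin (d + 1) → ℝ) ≃ₗ[ℝ] (S → ℝ) :=
    LinearEquiv.ofInjectiveOfFinrankEq T₀ hT₀ (by simp [hS])
  have hT (y : Fin (d + 1) → ℝ) (s : S) : T y s = lorentzForm d (u s) y := rfl
  have hTu (t : S) : T (u t) = (titsSimplex M).b t := by
    funext s
    rw [hT, hu]
    rfl
  refine ⟨T.symm, fun γ hγ => ?_⟩
  induction hγ using Subgroup.closure_induction with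
  | mem γ h =>
    obtain ⟨s, rfl⟩ := h
    have hrefl (y : Fin (d + 1) → ℝ) :
        ((T.symm.symm.trans ((titsSimplex M).refl s)).trans T.symm) y =
          y - lorentzForm d (u s) y • u s := by
      apply T.injective
      rw [map_sub, map_smul, hTu]
      simp only [LinearEquiv.symm_symm, LinearEquiv.trans_apply, LinearEquiv.apply_symm_apply]
      rw [CoxeterPolytope.refl_apply]
      rfl
    have hus : lorentzForm d (u s) (u s) = 2 := by rw [hu, cosineMatrix_self]
    refine ⟨fun x y => ?_, fun x hx hx0 => ?_⟩
    · rw [hrefl, hrefl, lorentzForm_sub_smul, lorentzForm_comm _ y, lorentzForm_comm _ (u s),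
        lorentzForm_sub_smul, lorentzForm_sub_smul, hus, lorentzForm_comm y x,
        lorentzForm_comm y (u s)]
      ring
    · rw [hrefl]
      exact last_pos_of_reflection hus hx hx0
  | one =>
    have : (T.symm.symm.trans (1 : (S → ℝ) ≃ₗ[ℝ] (S → ℝ))).trans T.symm =
        LinearEquiv.refl ℝ _ := by
      ext1 y
      simp
    rw [this]
    exact ⟨fun _ _ => rfl, fun _ _ h => h⟩
  | mul γ γ' _ _ h h' =>
    have hmul (y : Fin (d + 1) → ℝ) : ((T.symm.symm.trans (γ * γ')).trans T.symm) y =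
        ((T.symm.symm.trans γ).trans T.symm) (((T.symm.symm.trans γ').trans T.symm) y) := by
      simp
    refine ⟨fun x y => ?_, fun x hx hx0 => ?_⟩
    · rw [hmul, hmul, h.1, h'.1]
    · rw [hmul]
      exact h.2 _ (by rwa [h'.1]) (h'.2 x hx hx0)
  | inv γ _ h =>
    exact h.inv

end TitsSimplex

end ProjCoxeter

open ProjCoxeter
/-- `M` is a labeled simplex of dimension `d ≥ 4` with set of facets `S`, and `M.Group` is its
Coxeter group. -/
theorem theorem3p1 {S : Type*} [Fintype S] (d : ℕ) (hd : 4 ≤ d) (hS : Fintype.card S = d + 1)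
    (M : CoxeterMatrix S) (hirr : IsIrreducible M) (hlarge : IsLargeGroup M.Group)
    (hperf : IsTwoPerfect M) :
    -- the deformation space is an open cell of dimension `n = e₊ - d ∈ {0, 1, 2}`
    (∃ n : ℕ, edgeCount M = d + n ∧ n ∈ ({0, 1, 2} : Set ℕ) ∧
      Nonempty (DeformationSpace M ≃ₜ (Fin n → ℝ)) ∧
      -- the normalized cyclic products of the relevant circuits are well defined on it, and map
      -- it homeomorphically onto a linear subspace of dimension `n`
      ∃ R : DeformationSpace M → (RelevantCircuit M → ℝ),
        (∀ (P : CoxeterPolytope S (S → ℝ)) (hP : P.Realizes M) (C : RelevantCircuit M),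
          R (DeformationSpace.mk P hP) C = normalizedCyclicProduct P.cartanMatrix C) ∧
        IsEmbedding R ∧
        ∃ H : Submodule ℝ (RelevantCircuit M → ℝ),
          Module.finrank ℝ H = n ∧ Set.range R = (H : Set (RelevantCircuit M → ℝ))) ∧
    -- the class of the Tits simplex is the only hyperbolic one
    ∃ hT : (titsSimplex M).Realizes M,
      ∀ (P : CoxeterPolytope S (S → ℝ)) (hP : P.Realizes M),
        P.IsHyperbolic d ↔
          DeformationSpace.mk P hP = DeformationSpace.mk (titsSimplex M) hT := by
  classical
  have hpos : IsTwoPositive M := hperf.isTwoPositive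
  have h0 : ∀ s t, M s t ≠ 0 := label_ne_zero (by omega) hpos
  constructor
  · obtain ⟨e, he⟩ := exists_homeomorph hirr h0
    have hfin := finrank_range_circuitIntegral hirr
    have hle := edgeCount_le hS hd hpos
    have hR : cyclicProductMap M = Subtype.val ∘ e := funext fun p => (he p).symm
    set n := Module.finrank ℝ (LinearMap.range (circuitIntegral M)) with hn
    refine ⟨n, by omega, ?_, ⟨e.trans ?_⟩, cyclicProductMap M,
      fun P hP C => congrFun (cyclicProductMap_mk hP) C, ?_, LinearMap.range (circuitIntegral M),
      rfl, ?_⟩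
    · have : n = 0 ∨ n = 1 ∨ n = 2 := by omega
      simpa using this
    · exact (ContinuousLinearEquiv.ofFinrankEq (by rw [Module.finrank_fin_fun])).toHomeomorph
    · rw [hR]
      exact IsEmbedding.subtypeVal.comp e.isEmbedding
    · rw [hR, Set.range_comp, e.surjective.range_eq, Set.image_univ, Subtype.range_coe]
  · have hT : (titsSimplex M).Realizes M := realizes_coxeterSimplex (isCartanOf_cosineMatrix M) h0
    have hneg : ∃ v, cosForm M v v < 0 := by
      by_contra! h
      exact not_isLargeGroup_of_posSemidef M h hlarge
    obtain ⟨u, hu, hu0⟩ := exists_lorentz_gram hS (by omega) hpos hneg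
    refine ⟨hT, fun P hP => ⟨fun h => ?_, fun h => ?_⟩⟩
    · apply cyclicProductMap_injective hirr h0
      rw [cyclicProductMap_mk, cyclicProductMap_mk]
      funext C
      rw [h.normalizedCyclicProduct_eq_zero, normalizedCyclicProduct_titsSimplex]
    · exact (isHyperbolic_titsSimplex hS hu hu0).of_isomorphic (Quotient.exact h)
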